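/- Let $T>0$, let $(\Omega,\mathcal A,\mathbb P,(\mathcal F_t)_{t\in[0,T]})$ be a filtered probability space, let $(w_t)_{t\in[0,T]}$ be a standard real Brownian motion on it (adapted to $(\mathcal F_t)$, $w_0=0$ a.s., a.s. continuous paths, and for $s\le t$ the increment $w_t-w_s$ is independent of $\mathcal F_s$ with law $\mathcal N(0,t-s)$), and let $X$ be a real Banach space with dual $X^*$. A function $F:\mathbb R\to X$ is \emph{first type Birkhoff integrable} ($Bi_1$-integrable) on a compact interval $A$ with respect to Lebesgue measure $\lambda$, with integral $(Bi_1)\int_A F\,d\lambda=\mathcal I\in X$, if for every $\varepsilon>0$ there is a finite or countable partition $P_\varepsilon$ of $A$ into measurable sets such that for every finite or countable measurable partition $(U_n)_n$ of $A$ finer than $P_\varepsilon$ and all $s_n\in U_n$ one has $\limsup_n\big\|\sum_{k\le n}F(s_k)\lambda(U_k)-\mathcal I\big\|<\varepsilon$. A function $\Phi$ with values in $X$ is \emph{stochastic Birkhoff integrable} ($Bi_1^\star$-integrable) with respect to $w$ on $[0,T]$ if it is (Fréchet) differentiable on $[0,T]$ with derivative $\Phi'$ (one-sided at the endpoints) and,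 for every $\omega\in\Omega$, the function $s\mapsto \Phi'(s)\,w_s(\omega)$ is $Bi_1$-integrable on $[0,T]$ with respect to Lebesgue measure. In that case, for $[a,b]\subset[0,T]$, $$(Bi_1^\star)\!\int_a^b\Phi(r)\,dw_r:=\Phi(b)w_b-\Phi(a)w_a-(Bi_1)\!\int_{[a,b]}\Phi'(r)w_r\,dr .$$ Let $\Phi$ be $Bi_1^\star$-integrable with respect to $w$ on $[0,T]$, and suppose that $\Phi$ is strongly measurable and differentiable on $[0,T]$ and that, for every $x^*\in X^*$, $\langle x^*,\Phi(\cdot)\rangle\in L^2([0,T])$ and $\frac{d}{dt}\langle x^*,\Phi(t)\rangle=\langle x^*,\Phi'(t)\rangle$ on $[0,T]$. Then for every $x^*\in X^*$ the process $\langle x^*,\Phi\rangle$ is Itô integrable with respect to $w$ on $[0,T]$ (it is progressively measurable and $\mathbb E\int_0^T\langle x^*,\Phi(s)\rangle^2ds<\infty$), and for every $t\in[0,T]$, almost surely, $$\Big\langle x^*,(Bi_1^\star)\!\int_0^t\Phi(s)\,dw_s\Big\rangle=\int_0^t\langle x^*,\Phi(s)\rangle\,dw_s ,$$ where the right-hand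 side is the classical Itô integral, i.e. the $L^2(\mathbb P)$-limit of the elementary integrals of simple adapted processes converging to $\langle x^*,\Phi\rangle$ in $L^2(\mathbb P\otimes ds)$ on $[0,t]$. -/

import Mathlib

open MeasureTheory ProbabilityTheory Filter Set
open scoped NNReal ENNReal Topology

noncomputable section

namespace BirkhoffIto

/-! ### The first type Birkhoff integral -/

section Birkhoff

variable {α X : Type*} [MeasurableSpace α] [NormedAddCommGroup X] [NormedSpace ℝ X]

/-- A finite or countable partition of `A` into measurable sets, listed as a sequence.  Empty
members are allowed only so that finite partitions can be listed by `ℕ` too. -/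
structure IsPartition (A : Set α) (U : ℕ → Set α) : Prop where
  measurable : ∀ n, MeasurableSet (U n)
  disjoint : Pairwise fun i j => Disjoint (U i) (U j)
  cover : ⋃ n, U n = A

/-- `U` is finer than `V`. -/
def IsFiner (U V : ℕ → Set α) : Prop := ∀ n, ∃ m, U n ⊆ V m

/-- `I` is the first type Birkhoff integral of `Φ` over `A` with respect to the scalar measure `ν`
(finite on `A`).  The `limsup` is taken in `[0, ∞]`, so that it is `∞` for unbounded partial
sums.  Empty members of a partition carry no tag and contribute `0`. -/
def HasBirkhoffIntegral [Nonempty α] (Φ : α → X) (A : Set α) (ν : Measure α) (I : X) : Prop :=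
  ∀ ε : ℝ, 0 < ε → ∃ V : ℕ → Set α, IsPartition A V ∧
    ∀ U : ℕ → Set α, IsPartition A U → IsFiner U V →
      ∀ x : ℕ → α, (∀ n, (U n).Nonempty → x n ∈ U n) →
        limsup (fun n => ‖∑ k ∈ Finset.range n, ν.real (U k) • Φ (x k) - I‖ₑ) atTop
          < ENNReal.ofReal ε

/-- First type Birkhoff integrability over `A`. -/
def BirkhoffIntegrable [Nonempty α] (Φ : α → X) (A : Set α) (ν : Measure α) : Prop :=
  ∃ I : X, HasBirkhoffIntegral Φ A ν I

open Classical in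
/-- The first type Birkhoff integral over `A` (`0` if `Φ` is not integrable over `A`). -/
def birkhoffIntegral [Nonempty α] (Φ : α → X) (A : Set α) (ν : Measure α) : X :=
  if h : BirkhoffIntegrable Φ A ν then h.choose else 0

end Birkhoff

/-! ### Brownian motion on a filtered probability space, over the time interval `[0, T]` -/

section Ito

variable {Ω : Type*} {mΩ : MeasurableSpace Ω}

/-- `w` is a standard Brownian motion on `[0, T]` with respect to the filtration `𝓕`. -/
structure IsBrownianMotion (𝓕 : Filtration ℝ≥0 mΩ) (P : Measure Ω) (T : ℝ≥0)
    (w : ℝ≥0 → Ω → ℝ) : Prop where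
  adapted : ∀ t ≤ T, Measurable[𝓕 t] (w t)
  zero : ∀ᵐ ω ∂P, w 0 ω = 0
  law : ∀ s t, s ≤ t → t ≤ T → HasLaw (fun ω => w t ω - w s ω) (gaussianReal 0 (t - s)) P
  indep : ∀ s t, s ≤ t → t ≤ T →
    Indep (𝓕 s) (MeasurableSpace.comap (fun ω => w t ω - w s ω) inferInstance) P
  continuous : ∀ᵐ ω ∂P, ContinuousOn (fun t => w t ω) (Icc 0 T)

/-! ### The classical scalar Itô integral -/

/-- A simple process `∑ i < n, ξ i · 1_(τ i, τ (i+1)]`, where `τ 0 ≤ τ 1 ≤ …` and `ξ i` is bounded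
and `𝓕 (τ i)`-measurable. -/
structure SimpleProcess (𝓕 : Filtration ℝ≥0 mΩ) where
  n : ℕ
  τ : ℕ → ℝ≥0
  ξ : ℕ → Ω → ℝ
  mono : Monotone τ
  measurable : ∀ i, Measurable[𝓕 (τ i)] (ξ i)
  bounded : ∀ i, ∃ C : ℝ, ∀ ω, |ξ i ω| ≤ C

/-- The value of a simple process at time `s`. -/
def SimpleProcess.eval {𝓕 : Filtration ℝ≥0 mΩ} (S : SimpleProcess 𝓕) (s : ℝ≥0) (ω : Ω) : ℝ :=
  ∑ i ∈ Finset.range S.n, (Ioc (S.τ i) (S.τ (i + 1))).indicator (fun _ => S.ξ i ω) s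

/-- The elementary stochastic integral of a simple process over `[0, t]`. -/
def SimpleProcess.integral {𝓕 : Filtration ℝ≥0 mΩ} (S : SimpleProcess 𝓕) (w : ℝ≥0 → Ω → ℝ)
    (t : ℝ≥0) (ω : Ω) : ℝ :=
  ∑ i ∈ Finset.range S.n, S.ξ i ω * (w (min (S.τ (i + 1)) t) ω - w (min (S.τ i) t) ω)

/-- The process `H` is Itô integrable over `[0, T]`: it is progressively measurable on `[0, T]`,
and `𝔼 ∫_0^T H_s² ds < ∞`. -/
structure ItoIntegrable (𝓕 : Filtration ℝ≥0 mΩ) (P : Measure Ω) (T : ℝ≥0)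
    (H : ℝ≥0 → Ω → ℝ) : Prop where
  progressive : ∀ t ≤ T,
    StronglyMeasurable[Subtype.instMeasurableSpace.prod (𝓕 t)] fun p : Iic t × Ω => H p.1 p.2
  square_integrable : (∫⁻ ω, (∫⁻ s in Icc 0 (T : ℝ), ‖H s.toNNReal ω‖ₑ ^ 2) ∂P) < ∞

/-- `Y` is (a version of) the Itô integral `∫_0^t H dw`: the limit in `L²(P)` of the elementary
integrals of simple processes that converge to `H` in `L²(P ⊗ ds)` on `[0, t]`. -/
def HasItoIntegral (𝓕 : Filtration ℝ≥0 mΩ) (P : Measure Ω) (w : ℝ≥0 → Ω → ℝ)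
    (H : ℝ≥0 → Ω → ℝ) (t : ℝ≥0) (Y : Ω → ℝ) : Prop :=
  MemLp Y 2 P ∧ ∃ S : ℕ → SimpleProcess 𝓕,
    Tendsto (fun n => ∫⁻ ω,
      (∫⁻ s in Icc 0 (t : ℝ), ‖(S n).eval s.toNNReal ω - H s.toNNReal ω‖ₑ ^ 2) ∂P) atTop (𝓝 0) ∧
    Tendsto (fun n => eLpNorm (fun ω => (S n).integral w t ω - Y ω) 2 P) atTop (𝓝 0)

/-! ### The stochastic Birkhoff integral -/

variable {X : Type*} [NormedAddCommGroup X] [NormedSpace ℝ X]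

/-- `Φ` is stochastic Birkhoff integrable on `[0, T]`: it is differentiable on `[0, T]` (one-sidedly
at the ends) and every path of `Φ' w` is first type Birkhoff integrable for Lebesgue measure. -/
structure StochasticBirkhoffIntegrable (w : ℝ≥0 → Ω → ℝ) (T : ℝ≥0) (Φ : ℝ → X) : Prop where
  differentiable : DifferentiableOn ℝ Φ (Icc 0 (T : ℝ))
  integrable : ∀ ω, BirkhoffIntegrable
    (fun s : ℝ => w s.toNNReal ω • derivWithin Φ (Icc 0 (T : ℝ)) s) (Icc 0 (T : ℝ)) volume

/-- The stochastic Birkhoff integral over `[a, b] ⊆ [0, T]`,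
`Φ(b) w_b - Φ(a) w_a - ∫_[a,b] Φ'(r) w_r dr`. -/
def stochasticBirkhoffIntegral (w : ℝ≥0 → Ω → ℝ) (T : ℝ≥0) (Φ : ℝ → X) (a b : ℝ≥0) (ω : Ω) : X :=
  w b ω • Φ b - w a ω • Φ a -
    birkhoffIntegral (fun s : ℝ => w s.toNNReal ω • derivWithin Φ (Icc 0 (T : ℝ)) s)
      (Icc (a : ℝ) b) volume

/-- `Φ` is strongly measurable and differentiable on `[0, T]`, and every `⟨x*, Φ⟩` is square
integrable with derivative `⟨x*, Φ'⟩`. -/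
structure AdditionalHypothesis (T : ℝ≥0) (Φ : ℝ → X) : Prop where
  stronglyMeasurable : StronglyMeasurable ((Icc 0 (T : ℝ)).domRestrict Φ)
  differentiable : DifferentiableOn ℝ Φ (Icc 0 (T : ℝ))
  memLp : ∀ f : StrongDual ℝ X, MemLp (fun t => f (Φ t)) 2 (volume.restrict (Icc 0 (T : ℝ)))
  hasDeriv : ∀ f : StrongDual ℝ X, ∀ t ∈ Icc 0 (T : ℝ),
    HasDerivWithinAt (fun t => f (Φ t)) (f (derivWithin Φ (Icc 0 (T : ℝ)) t)) (Icc 0 (T : ℝ)) t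

end Ito

end BirkhoffIto

end

/-!
For `φ = ⟨f, Φ⟩` with derivative `ψ = ⟨f, Φ'⟩` the claim is the integration by parts formula
`∫₀ᵗ φ dw = φ(t) w_t - φ(0) w_0 - ∫₀ᵗ ψ(s) w_s ds` for a deterministic integrand.

*From Birkhoff to Lebesgue.* Since the defining condition holds for every listing of a partition,
it is equivalent to its unconditional form, in which all large enough finite sums are close to the
integral (`hasBirkhoffIntegral_iff`). In this form integrability passes to measurable subsets, by
the Cauchy criterion and completeness of `X` (`BirkhoffIntegrable.mono`). A measurable real function
is moreover seen to be Lebesgue integrable with the same integral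
(`HasUnconditionalIntegral.integrableOn_and_setIntegral_eq`). Hence on almost every path `ψ w` is
Lebesgue integrable on `[0, T]`, and `f` maps the Birkhoff integral over `[0, t]` to `∫₀ᵗ ψ w ds`.

*Integrability of `ψ`.* Near every `r > 0` some such path does not vanish, so `ψ` itself is
integrable on `[ε, T]` for `ε > 0` (`IsBrownianMotion.integrableOn_of_ae_integrableOn_mul`).
It may fail to be integrable near `0`.

*The isometry.* The Gram matrices of the indicators `1_(0, u]` and of the increments `w_u - w_0`
agree, so the closed span of the pairs `(1_(0, u], w_u - w_0)` in `L²([0, T]) × L²(P)` is the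
graph of an isometry, the Wiener integral (`IsBrownianMotion.norm_fst_eq_norm_snd`). Over `[ε, t]` summation by
parts shows that the left-point sums converge pathwise to the right-hand side of the formula
(`tendsto_sum_mul_increment`), and they converge in `L²(P)` to the Wiener integral; so the formula
holds there. Letting `ε → 0`, pathwise on one side and by the isometry on the other, gives it over
`[0, t]`, where the Wiener integral is the limit of the integrals of left-point simple processes
(`IsBrownianMotion.hasItoIntegral_deterministic`).
-/

namespace BirkhoffIto

/-! ### Operations on countable families of sets -/

section Families

variable {α : Type*}

/-- `x` chooses a point in every nonempty member of `U`. -/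
def IsTag (U : ℕ → Set α) (x : ℕ → α) : Prop := ∀ n, (U n).Nonempty → x n ∈ U n

lemma exists_isTag [Nonempty α] (U : ℕ → Set α) : ∃ x, IsTag U x := by
  classical
  refine ⟨fun n => if h : (U n).Nonempty then h.some else Classical.arbitrary α, fun n h => ?_⟩
  simpa [h] using h.some_mem

lemma IsFiner.refl (U : ℕ → Set α) : IsFiner U U := fun n => ⟨n, Subset.rfl⟩

lemma IsFiner.trans {U V W : ℕ → Set α} (h : IsFiner U V) (h' : IsFiner V W) : IsFiner U W := by
  intro n
  obtain ⟨m, hm⟩ := h n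
  obtain ⟨k, hk⟩ := h' m
  exact ⟨k, hm.trans hk⟩

/-- The members of `U`, with the `i`-th one moved to position `r i` and empty sets at the
positions outside the range of `r`. -/
def spread (U : ℕ → Set α) (r : ℕ → ℕ) (n : ℕ) : Set α := ⋃ i, ⋃ (_ : r i = n), U i

lemma spread_apply {U : ℕ → Set α} {r : ℕ → ℕ} (hr : Function.Injective r) (i : ℕ) :
    spread U r (r i) = U i := by
  ext a
  simp only [spread, mem_iUnion, exists_prop]
  exact ⟨fun ⟨j, hj, ha⟩ => hr hj ▸ ha, fun ha => ⟨i, rfl, ha⟩⟩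

lemma spread_eq_empty {U : ℕ → Set α} {r : ℕ → ℕ} {n : ℕ} (hn : ∀ i, r i ≠ n) :
    spread U r n = ∅ := by
  ext a
  simp [spread, hn]

lemma isFiner_spread (U : ℕ → Set α) {r : ℕ → ℕ} (hr : Function.Injective r) :
    IsFiner (spread U r) U := by
  intro n
  by_cases hn : ∃ i, r i = n
  · obtain ⟨i, rfl⟩ := hn
    exact ⟨i, (spread_apply hr i).subset⟩
  · push Not at hn
    exact ⟨0, by simp [spread_eq_empty hn]⟩

/-- The common refinement of two partitions. -/
def commonRefinement (U V : ℕ → Set α) (n : ℕ) : Set α := U n.unpair.1 ∩ V n.unpair.2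

lemma isFiner_commonRefinement_left (U V : ℕ → Set α) : IsFiner (commonRefinement U V) U :=
  fun n => ⟨n.unpair.1, inter_subset_left⟩

lemma isFiner_commonRefinement_right (U V : ℕ → Set α) : IsFiner (commonRefinement U V) V :=
  fun n => ⟨n.unpair.2, inter_subset_right⟩

/-- The listing that alternates between the entries of `u` and those of `v`. -/
def interleave {β : Type*} (u v : ℕ → β) (n : ℕ) : β :=
  Sum.elim u v (Equiv.natSumNatEquivNat.symm n)

lemma IsFiner.interleave {U W V : ℕ → Set α} (hU : IsFiner U V) (hW : IsFiner W V) :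
    IsFiner (interleave U W) V := by
  intro n
  unfold BirkhoffIto.interleave
  cases Equiv.natSumNatEquivNat.symm n
  exacts [hU _, hW _]

lemma IsTag.interleave {U W : ℕ → Set α} {x y : ℕ → α} (hx : IsTag U x) (hy : IsTag W y) :
    IsTag (interleave U W) (interleave x y) := by
  intro n
  unfold BirkhoffIto.interleave
  cases Equiv.natSumNatEquivNat.symm n
  exacts [hx _, hy _]

end Families

/-! ### Unconditional form of the Birkhoff integral -/

section Birkhoff

variable {α X : Type*} [MeasurableSpace α] [NormedAddCommGroup X] [NormedSpace ℝ X]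

/-- The finite sum `∑ k ∈ t, ν (U k) • Φ (x k)`. -/
noncomputable def taggedSum (ν : Measure α) (Φ : α → X) (U : ℕ → Set α) (x : ℕ → α)
    (t : Finset ℕ) : X :=
  ∑ k ∈ t, ν.real (U k) • Φ (x k)

lemma IsPartition.measurableSet {A : Set α} {U : ℕ → Set α} (hU : IsPartition A U) :
    MeasurableSet A := by
  rw [← hU.cover]
  exact MeasurableSet.iUnion hU.measurable

lemma IsPartition.subset {A : Set α} {U : ℕ → Set α} (hU : IsPartition A U) (n : ℕ) :
    U n ⊆ A := by
  rw [← hU.cover]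
  exact subset_iUnion U n

lemma IsPartition.spread {A : Set α} {U : ℕ → Set α} (hU : IsPartition A U) {r : ℕ → ℕ} :
    IsPartition A (spread U r) where
  measurable n := MeasurableSet.iUnion fun i => MeasurableSet.iUnion fun _ => hU.measurable i
  disjoint m n hmn := by
    refine Set.disjoint_left.2 ?_
    simp only [BirkhoffIto.spread, mem_iUnion, exists_prop]
    rintro a ⟨i, hi, hai⟩ ⟨j, hj, haj⟩
    have hij : i ≠ j := by rintro rfl; exact hmn (hi.symm.trans hj)
    exact Set.disjoint_left.1 (hU.disjoint hij) hai haj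
  cover := by
    rw [← hU.cover]
    ext a
    simp only [BirkhoffIto.spread, mem_iUnion, exists_prop]
    exact ⟨fun ⟨_, i, _, h⟩ => ⟨i, h⟩, fun ⟨i, h⟩ => ⟨r i, i, rfl, h⟩⟩

/-- An increasing sequence of finite sets exhausting `ℕ` can be turned into initial segments by
an injective change of positions. -/
lemma exists_injective_lt_iff_mem (t : ℕ → Finset ℕ) (ht : Monotone t) (hmem : ∀ j, j ∈ t j) :
    ∃ r : ℕ → ℕ, Function.Injective r ∧ ∀ j, ∃ N, j ≤ N ∧ ∀ i, r i < N ↔ i ∈ t j := by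
  classical
  have hex : ∀ i, ∃ j, i ∈ t j := fun i => ⟨i, hmem i⟩
  -- `J i` is the stage at which `i` appears, and stage `j` occupies the positions in
  -- `[C j, C (j + 1))`.
  let J : ℕ → ℕ := fun i => Nat.find (hex i)
  let D : ℕ → ℕ := fun l => (t l).sup id + 1
  let C : ℕ → ℕ := fun j => ∑ l ∈ Finset.range j, D l
  have hC : Monotone C := fun a b hab =>
    Finset.sum_le_sum_of_subset (Finset.range_subset_range.2 hab)
  have hJ : ∀ i, i ∈ t (J i) := fun i => Nat.find_spec (hex i)
  have hCs : ∀ j, C (j + 1) = C j + D j := fun j => Finset.sum_range_succ _ _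
  have hlt : ∀ i, C (J i) + i < C (J i + 1) := by
    intro i
    have h1 : i ≤ (t (J i)).sup id := Finset.le_sup (f := id) (hJ i)
    have h2 : D (J i) = (t (J i)).sup id + 1 := rfl
    have h3 := hCs (J i)
    omega
  refine ⟨fun i => C (J i) + i, ?_, fun j => ⟨C (j + 1), ?_, fun i => ?_⟩⟩
  · intro i i' h
    have h' : C (J i) + i = C (J i') + i' := h
    rcases lt_trichotomy (J i) (J i') with hl | hl | hl
    · have := hC (Nat.succ_le_of_lt hl)
      have := hlt i
      simp only [Nat.succ_eq_add_one] at *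
      omega
    · rw [hl] at h'
      omega
    · have := hC (Nat.succ_le_of_lt hl)
      have := hlt i'
      simp only [Nat.succ_eq_add_one] at *
      omega
  · have : ∀ j, j ≤ C j := by
      intro j
      induction j with
      | zero => simp
      | succ j ih =>
        have h3 := hCs j
        have h2 : D j = (t j).sup id + 1 := rfl
        omega
    exact (Nat.le_succ j).trans (this (j + 1))
  · constructor
    · intro h
      by_contra hn
      have hj : j < J i := by
        by_contra hle
        exact hn (ht (not_lt.1 hle) (hJ i))
      have h1 : C (j + 1) ≤ C (J i) := hC hj
      have h2 : C (J i) + i < C (j + 1) := h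
      omega
    · intro h
      have h1 : J i ≤ j := Nat.find_min' (hex i) h
      exact (hlt i).trans_le (hC (Nat.succ_le_succ h1))

/-- If the ordered partial sums stay close to `I` for every listing of the members of `U`, then
so do all large enough finite sums: otherwise some listing would run through bad finite sums
infinitely often. -/
lemma exists_finset_norm_taggedSum_sub_le {ν : Measure α} {Φ : α → X} {A : Set α}
    {V U : ℕ → Set α} {I : X} {ε : ℝ}
    (h : ∀ U : ℕ → Set α, IsPartition A U → IsFiner U V → ∀ x : ℕ → α,
      (∀ n, (U n).Nonempty → x n ∈ U n) →
        limsup (fun n => ‖∑ k ∈ Finset.range n, ν.real (U k) • Φ (x k) - I‖ₑ) atTop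
          < ENNReal.ofReal ε)
    (hU : IsPartition A U) (hUV : IsFiner U V) {x : ℕ → α} (hx : IsTag U x) :
    ∃ s : Finset ℕ, ∀ t, s ⊆ t → ‖taggedSum ν Φ U x t - I‖ ≤ ε := by
  classical
  by_contra hcon
  push Not at hcon
  choose g hg hgε using hcon
  let t : ℕ → Finset ℕ := fun j => Nat.rec (g {0}) (fun j s => g (s ∪ {j + 1})) j
  have ht : Monotone t := monotone_nat_of_le_succ fun j =>
    Finset.subset_union_left.trans (hg (t j ∪ {j + 1}))
  have hmem : ∀ j, j ∈ t j := by
    rintro (_ | j)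
    · exact hg {0} (by simp)
    · exact hg (t j ∪ {j + 1}) (by simp)
  have hbad : ∀ j, ε < ‖taggedSum ν Φ U x (t j) - I‖ := by
    rintro (_ | j)
    · exact hgε _
    · exact hgε _
  obtain ⟨r, hr, hN⟩ := exists_injective_lt_iff_mem t ht hmem
  have hinv : ∀ i, Function.invFun r (r i) = i := Function.leftInverse_invFun hr
  have key := h (spread U r) hU.spread ((isFiner_spread U hr).trans hUV)
    (fun n => x (Function.invFun r n)) (by
      intro n hn
      by_cases hex : ∃ i, r i = n
      · obtain ⟨i, rfl⟩ := hex
        rw [spread_apply hr] at hn ⊢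
        rw [hinv]
        exact hx i hn
      · push Not at hex
        rw [spread_eq_empty hex] at hn
        simp at hn)
  refine absurd key (not_lt.2 (le_limsup_of_frequently_le ?_))
  rw [frequently_atTop]
  intro j
  obtain ⟨N, hjN, hiff⟩ := hN j
  refine ⟨N, hjN, ?_⟩
  have hsum : taggedSum ν Φ U x (t j) = ∑ k ∈ Finset.range N,
      ν.real (spread U r k) • Φ (x (Function.invFun r k)) := by
    refine Finset.sum_of_injOn r hr.injOn ?_ ?_ ?_
    · intro i hi
      simpa using (hiff i).2 hi
    · intro k hk hk'
      have : spread U r k = ∅ := spread_eq_empty fun i hik =>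
        hk' ⟨i, (hiff i).1 (hik ▸ Finset.mem_range.1 hk), hik⟩
      simp [this]
    · intro i _
      rw [spread_apply hr, hinv]
  rw [← hsum, ← ofReal_norm]
  exact ENNReal.ofReal_le_ofReal (hbad j).le

/-- The Birkhoff integral with unconditional approximation: the sums over all large enough finite
sets of members of `U` are close to `I`. -/
def HasUnconditionalIntegral (Φ : α → X) (A : Set α) (ν : Measure α) (I : X) : Prop :=
  ∀ ε : ℝ, 0 < ε → ∃ V : ℕ → Set α, IsPartition A V ∧
    ∀ U : ℕ → Set α, IsPartition A U → IsFiner U V → ∀ x : ℕ → α, IsTag U x →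
      ∃ s : Finset ℕ, ∀ t, s ⊆ t → ‖taggedSum ν Φ U x t - I‖ ≤ ε

lemma hasBirkhoffIntegral_iff [Nonempty α] {Φ : α → X} {A : Set α} {ν : Measure α} {I : X} :
    HasBirkhoffIntegral Φ A ν I ↔ HasUnconditionalIntegral Φ A ν I := by
  constructor
  · intro h ε hε
    obtain ⟨V, hV, hVU⟩ := h ε hε
    exact ⟨V, hV, fun U hU hUV x hx => exists_finset_norm_taggedSum_sub_le hVU hU hUV hx⟩
  · intro h ε hε
    obtain ⟨V, hV, hVU⟩ := h (ε / 2) (half_pos hε)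
    refine ⟨V, hV, fun U hU hUV x hx => ?_⟩
    obtain ⟨s, hs⟩ := hVU U hU hUV x hx
    refine lt_of_le_of_lt (b := ENNReal.ofReal (ε / 2)) ?_
      ((ENNReal.ofReal_lt_ofReal_iff hε).2 (half_lt_self hε))
    refine limsup_le_of_le (by isBoundedDefault) ?_
    filter_upwards [eventually_ge_atTop (s.sup id + 1)] with n hn
    rw [← ofReal_norm]
    refine ENNReal.ofReal_le_ofReal (hs (Finset.range n) fun i hi => ?_)
    have : i ≤ s.sup id := Finset.le_sup (f := id) hi
    exact Finset.mem_range.2 (by omega)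

/-! ### Restriction to a subset -/

lemma IsPartition.commonRefinement {A B : Set α} {U V : ℕ → Set α} (hU : IsPartition A U)
    (hV : IsPartition B V) : IsPartition (A ∩ B) (commonRefinement U V) where
  measurable n := (hU.measurable _).inter (hV.measurable _)
  disjoint m n hmn := by
    refine Set.disjoint_left.2 ?_
    rintro a ⟨h1, h2⟩ ⟨h3, h4⟩
    have e1 : m.unpair.1 = n.unpair.1 := by
      by_contra hne
      exact Set.disjoint_left.1 (hU.disjoint hne) h1 h3
    have e2 : m.unpair.2 = n.unpair.2 := by
      by_contra hne
      exact Set.disjoint_left.1 (hV.disjoint hne) h2 h4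
    exact hmn (by rw [← Nat.pair_unpair m, ← Nat.pair_unpair n, e1, e2])
  cover := by
    rw [← hU.cover, ← hV.cover]
    ext a
    simp only [BirkhoffIto.commonRefinement, mem_iUnion, mem_inter_iff]
    constructor
    · rintro ⟨n, h1, h2⟩
      exact ⟨⟨_, h1⟩, ⟨_, h2⟩⟩
    · rintro ⟨⟨i, h1⟩, ⟨j, h2⟩⟩
      exact ⟨Nat.pair i j, by simpa using h1, by simpa using h2⟩

lemma isPartition_single {B : Set α} (hB : MeasurableSet B) :
    IsPartition B (fun n : ℕ => if n = 0 then B else ∅) where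
  measurable n := by
    split_ifs
    exacts [hB, MeasurableSet.empty]
  disjoint m n hmn := by
    change Disjoint (if m = 0 then B else ∅) (if n = 0 then B else ∅)
    split_ifs with h1 h2
    · exact absurd (h1.trans h2.symm) hmn
    all_goals simp
  cover := by
    ext a
    simp only [mem_iUnion]
    refine ⟨fun ⟨n, hn⟩ => ?_, fun h => ⟨0, by simpa using h⟩⟩
    split_ifs at hn
    · exact hn
    · simp at hn

/-- The traces on `B` of the members of a partition of a larger set. -/
lemma IsPartition.exists_restrict {A B : Set α} {V : ℕ → Set α} (hV : IsPartition A V)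
    (hB : MeasurableSet B) (hBA : B ⊆ A) : ∃ V', IsPartition B V' ∧ IsFiner V' V :=
  ⟨_, by simpa [inter_eq_self_of_subset_right hBA]
      using hV.commonRefinement (isPartition_single hB),
    isFiner_commonRefinement_left _ _⟩

lemma IsPartition.interleave {B C : Set α} {U W : ℕ → Set α} (hU : IsPartition B U)
    (hW : IsPartition C W) (hBC : Disjoint B C) : IsPartition (B ∪ C) (interleave U W) where
  measurable n := by
    unfold BirkhoffIto.interleave
    cases Equiv.natSumNatEquivNat.symm n
    exacts [hU.measurable _, hW.measurable _]
  disjoint m n hmn := by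
    have hne : Equiv.natSumNatEquivNat.symm m ≠ Equiv.natSumNatEquivNat.symm n :=
      fun h => hmn (Equiv.injective _ h)
    unfold BirkhoffIto.interleave
    dsimp only
    generalize Equiv.natSumNatEquivNat.symm m = a at hne ⊢
    generalize Equiv.natSumNatEquivNat.symm n = b at hne ⊢
    rcases a with a | a <;> rcases b with b | b
    · exact hU.disjoint fun h => hne (h ▸ rfl)
    · exact hBC.mono (hU.subset a) (hW.subset b)
    · exact (hBC.mono (hU.subset b) (hW.subset a)).symm
    · exact hW.disjoint fun h => hne (h ▸ rfl)
  cover := by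
    rw [← hU.cover, ← hW.cover]
    ext a
    simp only [BirkhoffIto.interleave, mem_iUnion, mem_union]
    constructor
    · rintro ⟨n, hn⟩
      generalize Equiv.natSumNatEquivNat.symm n = b at hn
      rcases b with b | b
      exacts [Or.inl ⟨b, hn⟩, Or.inr ⟨b, hn⟩]
    · rintro (⟨i, hi⟩ | ⟨i, hi⟩)
      · exact ⟨Equiv.natSumNatEquivNat (Sum.inl i), by rw [Equiv.symm_apply_apply]; exact hi⟩
      · exact ⟨Equiv.natSumNatEquivNat (Sum.inr i), by rw [Equiv.symm_apply_apply]; exact hi⟩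

lemma taggedSum_interleave (ν : Measure α) (Φ : α → X) (U W : ℕ → Set α) (x y : ℕ → α)
    (s t : Finset ℕ) :
    taggedSum ν Φ (interleave U W) (interleave x y)
      ((s.disjSum t).map Equiv.natSumNatEquivNat.toEmbedding) =
      taggedSum ν Φ U x s + taggedSum ν Φ W y t := by
  simp only [taggedSum, Finset.sum_map, Finset.sum_disjSum, Equiv.coe_toEmbedding, interleave,
    Equiv.symm_apply_apply, Sum.elim_inl, Sum.elim_inr]

/-- The unconditional Cauchy condition for Birkhoff integrability. -/
def IsBirkhoffCauchy (Φ : α → X) (A : Set α) (ν : Measure α) : Prop :=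
  ∀ ε : ℝ, 0 < ε → ∃ V : ℕ → Set α, IsPartition A V ∧
    ∀ U U' : ℕ → Set α, IsPartition A U → IsFiner U V → IsPartition A U' → IsFiner U' V →
      ∀ x x' : ℕ → α, IsTag U x → IsTag U' x' → ∃ s s' : Finset ℕ, ∀ t t', s ⊆ t → s' ⊆ t' →
        ‖taggedSum ν Φ U x t - taggedSum ν Φ U' x' t'‖ ≤ ε

/-- Completing two tagged partitions of `B` by the same tagged partition of `A \ B` compares their
sums. -/
lemma HasUnconditionalIntegral.isBirkhoffCauchy [Nonempty α] {Φ : α → X} {A B : Set α}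
    {ν : Measure α} {I : X} (h : HasUnconditionalIntegral Φ A ν I) (hB : MeasurableSet B)
    (hBA : B ⊆ A) : IsBirkhoffCauchy Φ B ν := by
  classical
  intro ε hε
  obtain ⟨V, hV, hVU⟩ := h (ε / 2) (half_pos hε)
  obtain ⟨VB, hVB, hVBV⟩ := hV.exists_restrict hB hBA
  obtain ⟨W, hW, hWV⟩ := hV.exists_restrict (hV.measurableSet.diff hB) sdiff_subset
  obtain ⟨y, hy⟩ := exists_isTag W
  have hun : B ∪ A \ B = A := union_sdiff_cancel hBA
  have key : ∀ U, IsPartition B U → IsFiner U VB → ∀ x, IsTag U x → ∃ s r : Finset ℕ,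
      ∀ t q, s ⊆ t → r ⊆ q → ‖taggedSum ν Φ U x t + taggedSum ν Φ W y q - I‖ ≤ ε / 2 := by
    intro U hU hUV x hx
    have hP := hU.interleave hW disjoint_sdiff_right
    rw [hun] at hP
    obtain ⟨s, hs⟩ := hVU _ hP ((hUV.trans hVBV).interleave hWV) _ (hx.interleave hy)
    let s' : Finset (ℕ ⊕ ℕ) := s.map Equiv.natSumNatEquivNat.symm.toEmbedding
    refine ⟨s'.toLeft, s'.toRight, fun t q ht hq => ?_⟩
    rw [← taggedSum_interleave]
    refine hs _ fun i hi => ?_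
    rw [Finset.mem_map_equiv]
    have hi' : Equiv.natSumNatEquivNat.symm i ∈ s' := by
      rw [Finset.mem_map_equiv, Equiv.symm_symm, Equiv.apply_symm_apply]
      exact hi
    generalize Equiv.natSumNatEquivNat.symm i = b at hi' ⊢
    rcases b with b | b
    · exact Finset.inl_mem_disjSum.2 (ht (Finset.mem_toLeft.2 hi'))
    · exact Finset.inr_mem_disjSum.2 (hq (Finset.mem_toRight.2 hi'))
  refine ⟨VB, hVB, fun U U' hU hUV hU' hUV' x x' hx hx' => ?_⟩
  obtain ⟨s, r, hs⟩ := key U hU hUV x hx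
  obtain ⟨s', r', hs'⟩ := key U' hU' hUV' x' hx'
  refine ⟨s, s', fun t t' ht ht' => ?_⟩
  have h1 := hs t (r ∪ r') ht Finset.subset_union_left
  have h2 := hs' t' (r ∪ r') ht' Finset.subset_union_right
  calc ‖taggedSum ν Φ U x t - taggedSum ν Φ U' x' t'‖
      = ‖(taggedSum ν Φ U x t + taggedSum ν Φ W y (r ∪ r') - I) -
          (taggedSum ν Φ U' x' t' + taggedSum ν Φ W y (r ∪ r') - I)‖ := by congr 1; abel
    _ ≤ _ := norm_sub_le _ _
    _ ≤ ε / 2 + ε / 2 := add_le_add h1 h2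
    _ = ε := add_halves ε

lemma IsBirkhoffCauchy.exists_hasUnconditionalIntegral [Nonempty α] [CompleteSpace X] {Φ : α → X}
    {A : Set α} {ν : Measure α} (h : IsBirkhoffCauchy Φ A ν) :
    ∃ I, HasUnconditionalIntegral Φ A ν I := by
  let δ : ℕ → ℝ := fun m => 1 / ((m : ℝ) + 1)
  have hδ : ∀ m, 0 < δ m := fun m => Nat.one_div_pos_of_nat
  have hδanti : ∀ m n, m ≤ n → δ n ≤ δ m := fun m n hmn => Nat.one_div_le_one_div hmn
  choose V hV hVU using fun m => h (δ m) (hδ m)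
  let U : ℕ → ℕ → Set α := fun m => Nat.rec (V 0) (fun m R => commonRefinement R (V (m + 1))) m
  have hU : ∀ m, IsPartition A (U m) := by
    intro m
    induction m with
    | zero => exact hV 0
    | succ m ih => simpa using ih.commonRefinement (hV (m + 1))
  have hUself : ∀ m, IsFiner (U m) (V m) := by
    rintro (_ | m)
    · exact IsFiner.refl _
    · exact isFiner_commonRefinement_right _ _
  have hUV : ∀ m n, m ≤ n → IsFiner (U n) (V m) := by
    intro m n hmn
    induction n, hmn using Nat.le_induction with
    | base => exact hUself m
    | succ n _ ih => exact (isFiner_commonRefinement_left (U n) (V (n + 1))).trans ih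
  choose x hx using fun m => exists_isTag (U m)
  choose s s' hs using fun m => hVU m (U m) (U m) (hU m) (hUself m) (hU m) (hUself m)
    (x m) (x m) (hx m) (hx m)
  -- Comparing `U m` with itself gives a threshold that depends on `m` only, so that one finite sum
  -- can represent `U m` in the comparison with every other partition.
  let z : ℕ → X := fun m => taggedSum ν Φ (U m) (x m) (s' m)
  have hz : ∀ m t, s m ⊆ t → ‖taggedSum ν Φ (U m) (x m) t - z m‖ ≤ δ m := fun m t ht =>
    hs m t (s' m) ht Finset.Subset.rfl
  have hzz : ∀ m n, m ≤ n → ‖z m - z n‖ ≤ 3 * δ m := by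
    classical
    intro m n hmn
    obtain ⟨r, r', hr⟩ := hVU m (U m) (U n) (hU m) (hUself m) (hU n) (hUV m n hmn)
      (x m) (x n) (hx m) (hx n)
    have h1 := hz m (s m ∪ r) Finset.subset_union_left
    have h2 := hz n (s n ∪ r') Finset.subset_union_left
    have h3 := hr (s m ∪ r) (s n ∪ r') Finset.subset_union_right Finset.subset_union_right
    have h4 := hδanti m n hmn
    set a := taggedSum ν Φ (U m) (x m) (s m ∪ r)
    set b := taggedSum ν Φ (U n) (x n) (s n ∪ r')
    have h5 : z m - z n = (b - z n) + (a - b) - (a - z m) := by abel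
    rw [h5]
    have h6 := norm_sub_le ((b - z n) + (a - b)) (a - z m)
    have h7 := norm_add_le (b - z n) (a - b)
    linarith
  have hδ0 : Tendsto δ atTop (𝓝 0) := tendsto_one_div_add_atTop_nhds_zero_nat
  have hcauchy : CauchySeq z := by
    refine cauchySeq_of_le_tendsto_0' (fun m => 3 * δ m) (fun m n hmn => ?_) ?_
    · rw [dist_eq_norm]
      exact hzz m n hmn
    · simpa using hδ0.const_mul 3
  obtain ⟨I, hI⟩ := cauchySeq_tendsto_of_complete hcauchy
  have hzI : ∀ m, ‖z m - I‖ ≤ 3 * δ m := fun m =>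
    le_of_tendsto (tendsto_const_nhds.sub hI).norm
      ((eventually_ge_atTop m).mono fun n hn => hzz m n hn)
  refine ⟨I, fun ε hε => ?_⟩
  obtain ⟨m, hm⟩ := (hδ0.eventually (gt_mem_nhds (show (0 : ℝ) < ε / 5 by positivity))).exists
  refine ⟨V m, hV m, fun U' hU' hUV' x' hx' => ?_⟩
  obtain ⟨r, r', hr⟩ := hVU m U' (U m) hU' hUV' (hU m) (hUself m) x' (x m) hx' (hx m)
  refine ⟨r, fun t ht => ?_⟩
  classical
  have h1 := hr t (s m ∪ r') ht Finset.subset_union_right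
  have h2 := hz m (s m ∪ r') Finset.subset_union_left
  have h3 := hzI m
  set a := taggedSum ν Φ (U m) (x m) (s m ∪ r')
  set b := taggedSum ν Φ U' x' t
  have h5 : b - I = (b - a) + (a - z m) + (z m - I) := by abel
  rw [h5]
  have h6 := norm_add₃_le (a := b - a) (b := a - z m) (c := z m - I)
  linarith

lemma BirkhoffIntegrable.mono [Nonempty α] [CompleteSpace X] {Φ : α → X} {A B : Set α}
    {ν : Measure α} (h : BirkhoffIntegrable Φ A ν) (hB : MeasurableSet B) (hBA : B ⊆ A) :
    BirkhoffIntegrable Φ B ν := by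
  obtain ⟨I, hI⟩ := h
  obtain ⟨J, hJ⟩ := ((hasBirkhoffIntegral_iff.1 hI).isBirkhoffCauchy hB
    hBA).exists_hasUnconditionalIntegral
  exact ⟨J, hasBirkhoffIntegral_iff.2 hJ⟩

/-! ### Comparison with the Lebesgue integral -/

lemma taggedSum_congr {ν : Measure α} {Φ Ψ : α → X} {A : Set α} (h : EqOn Φ Ψ A)
    {U : ℕ → Set α} (hU : IsPartition A U) {x : ℕ → α} (hx : IsTag U x) (t : Finset ℕ) :
    taggedSum ν Φ U x t = taggedSum ν Ψ U x t := by
  refine Finset.sum_congr rfl fun k _ => ?_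
  rcases (U k).eq_empty_or_nonempty with hk | hk
  · simp [hk]
  · rw [h (hU.subset k (hx k hk))]

lemma HasUnconditionalIntegral.congr {Φ Ψ : α → X} {A : Set α} {ν : Measure α} {I : X}
    (h : HasUnconditionalIntegral Φ A ν I) (hΦΨ : EqOn Φ Ψ A) :
    HasUnconditionalIntegral Ψ A ν I := by
  intro ε hε
  obtain ⟨V, hV, hVU⟩ := h ε hε
  refine ⟨V, hV, fun U hU hUV x hx => ?_⟩
  simpa only [← taggedSum_congr hΦΨ hU hx] using hVU U hU hUV x hx

lemma HasUnconditionalIntegral.map {Φ : α → X} {A : Set α} {ν : Measure α} {I : X}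
    (h : HasUnconditionalIntegral Φ A ν I) (f : StrongDual ℝ X) :
    HasUnconditionalIntegral (fun a => f (Φ a)) A ν (f I) := by
  intro ε hε
  have hpos : 0 < ‖f‖ + 1 := by positivity
  obtain ⟨V, hV, hVU⟩ := h (ε / (‖f‖ + 1)) (div_pos hε hpos)
  refine ⟨V, hV, fun U hU hUV x hx => ?_⟩
  obtain ⟨s, hs⟩ := hVU U hU hUV x hx
  refine ⟨s, fun t ht => ?_⟩
  have e : taggedSum ν (fun a => f (Φ a)) U x t - f I = f (taggedSum ν Φ U x t - I) := by
    simp [taggedSum, map_sub, map_sum]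
  rw [e]
  calc ‖f (taggedSum ν Φ U x t - I)‖ ≤ ‖f‖ * ‖taggedSum ν Φ U x t - I‖ := f.le_opNorm _
    _ ≤ (‖f‖ + 1) * (ε / (‖f‖ + 1)) := by
      gcongr
      · linarith
      · exact hs t ht
    _ = ε := mul_div_cancel₀ _ hpos.ne'

/-- Real numbers whose large finite sums stay within bounded distance of a number are summable,
and their sum is within that distance. -/
lemma summable_and_abs_tsum_sub_le {a : ℕ → ℝ} {I ε : ℝ} {s : Finset ℕ}
    (h : ∀ t, s ⊆ t → |∑ k ∈ t, a k - I| ≤ ε) : Summable a ∧ |∑' k, a k - I| ≤ ε := by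
  classical
  -- every finite sum differs from one containing `s` by a sum over a part of `s`
  have hbound : ∀ t : Finset ℕ, |∑ k ∈ t, a k| ≤ ε + |I| + ∑ k ∈ s, |a k| := by
    intro t
    have h1 : ∑ k ∈ t ∪ s \ t, a k = ∑ k ∈ t, a k + ∑ k ∈ s \ t, a k :=
      Finset.sum_union Finset.disjoint_sdiff
    have h2 := h (t ∪ s \ t) (by simp)
    have h3 : |∑ k ∈ s \ t, a k| ≤ ∑ k ∈ s, |a k| :=
      (Finset.abs_sum_le_sum_abs _ _).trans
        (Finset.sum_le_sum_of_subset_of_nonneg Finset.sdiff_subset fun _ _ _ => abs_nonneg _)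
    have h4 : ∑ k ∈ t, a k = (∑ k ∈ t ∪ s \ t, a k - I) + I - ∑ k ∈ s \ t, a k := by
      rw [h1]; ring
    rw [h4]
    have h5 := abs_sub ((∑ k ∈ t ∪ s \ t, a k - I) + I) (∑ k ∈ s \ t, a k)
    have h6 := abs_add_le (∑ k ∈ t ∪ s \ t, a k - I) I
    linarith
  have hsum : Summable fun k => |a k| := by
    refine summable_of_sum_le (c := 2 * (ε + |I| + ∑ k ∈ s, |a k|)) (fun _ => abs_nonneg _) ?_
    intro t
    have h1 := hbound (t.filter fun k => 0 ≤ a k)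
    have h2 := hbound (t.filter fun k => ¬ 0 ≤ a k)
    have h3 : ∑ k ∈ t, |a k| =
        ∑ k ∈ t with 0 ≤ a k, a k - ∑ k ∈ t with ¬ 0 ≤ a k, a k := by
      rw [← Finset.sum_filter_add_sum_filter_not t (fun k => 0 ≤ a k) (fun k => |a k|),
        sub_eq_add_neg, ← Finset.sum_neg_distrib]
      congr 1
      · exact Finset.sum_congr rfl fun k hk => abs_of_nonneg (Finset.mem_filter.1 hk).2
      · exact Finset.sum_congr rfl fun k hk =>
          abs_of_neg (not_le.1 (Finset.mem_filter.1 hk).2)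
    rw [h3]
    have h4 := le_abs_self (∑ k ∈ t with 0 ≤ a k, a k)
    have h5 := neg_abs_le (∑ k ∈ t with ¬ 0 ≤ a k, a k)
    linarith
  have hsum' : Summable a := hsum.of_abs
  refine ⟨hsum', le_of_tendsto ((hsum'.hasSum.sub_const I).abs) ?_⟩
  exact (eventually_ge_atTop s).mono fun t ht => h t ht

/-- The partition of the space into the sets where `F` lies in `[k δ, (k + 1) δ)`, `k ∈ ℤ`. -/
lemma exists_isPartition_osc_le {F : α → ℝ} (hF : Measurable F) {δ : ℝ} (hδ : 0 < δ) :
    ∃ L : ℕ → Set α, IsPartition univ L ∧ ∀ n, ∀ a ∈ L n, ∀ b ∈ L n, |F a - F b| ≤ δ := by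
  let e : ℕ ≃ ℤ := Equiv.intEquivNat.symm
  refine ⟨fun n => {a | ⌊F a / δ⌋ = e n}, ⟨fun n => ?_, fun m n hmn => ?_, ?_⟩, ?_⟩
  · exact (hF.div_const δ).floor (measurableSet_singleton (e n))
  · refine Set.disjoint_left.2 ?_
    intro a (h1 : _ = _) (h2 : _ = _)
    exact hmn (e.injective (h1.symm.trans h2))
  · ext a
    simp only [mem_iUnion, mem_univ, iff_true]
    exact ⟨e.symm ⌊F a / δ⌋, by simp⟩
  · intro n a (ha : _ = _) b (hb : _ = _)
    have h := Int.abs_sub_lt_one_of_floor_eq_floor (ha.trans hb.symm)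
    rw [← sub_div, abs_div, abs_of_pos hδ, div_lt_one hδ] at h
    exact h.le

/-- For a measurable real function the Birkhoff integral is the Lebesgue integral: on a partition
refined by level sets of `F`, the tagged sums are the integrals of step functions uniformly close
to `F`. -/
lemma HasUnconditionalIntegral.integrableOn_and_setIntegral_eq [Nonempty α] {F : α → ℝ} {A : Set α}
    {ν : Measure α} {I : ℝ} (h : HasUnconditionalIntegral F A ν I) (hF : Measurable F)
    (hA : ν A ≠ ∞) : IntegrableOn F A ν ∧ ∫ a in A, F a ∂ν = I := by
  have key : ∀ ε : ℝ, 0 < ε → IntegrableOn F A ν ∧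
      |∫ a in A, F a ∂ν - I| ≤ ε * (ν.real A + 1) := by
    intro ε hε
    obtain ⟨V, hV, hVU⟩ := h ε hε
    obtain ⟨L, hL, hLosc⟩ := exists_isPartition_osc_le hF hε
    set U := commonRefinement V L
    have hU : IsPartition A U := by simpa using hV.commonRefinement hL
    obtain ⟨x, hx⟩ := exists_isTag U
    obtain ⟨s, hs⟩ := hVU U hU (isFiner_commonRefinement_left V L) x hx
    have hs' : ∀ t, s ⊆ t → |∑ k ∈ t, ν.real (U k) * F (x k) - I| ≤ ε := hs
    obtain ⟨hsum, htsum⟩ := summable_and_abs_tsum_sub_le hs'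
    have hUfin : ∀ k, ν (U k) ≠ ∞ := fun k => measure_ne_top_of_subset (hU.subset k) hA
    have hosc : ∀ k, ∀ a ∈ U k, ‖F a - F (x k)‖ ≤ ε := fun k a ha =>
      hLosc _ a ha.2 _ (hx k ⟨a, ha⟩).2
    have hνU : HasSum (fun k => ν.real (U k)) (ν.real A) := by
      have h1 := measure_iUnion (μ := ν) hU.disjoint hU.measurable
      rw [hU.cover] at h1
      have h2 := ENNReal.hasSum_toReal (h1 ▸ hA)
      rw [← ENNReal.tsum_toReal_eq hUfin, ← h1] at h2
      exact h2
    have hint : ∀ k, IntegrableOn F (U k) ν := by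
      intro k
      refine IntegrableOn.of_bound (hUfin k).lt_top hF.aestronglyMeasurable (|F (x k)| + ε) ?_
      refine (ae_restrict_iff' (hU.measurable k)).2 (ae_of_all _ fun a ha => ?_)
      have h1 := hosc k a ha
      have h2 := norm_sub_norm_le (F a) (F (x k))
      simp only [Real.norm_eq_abs] at *
      linarith
    have hdiff : ∀ k, |∫ a in U k, F a ∂ν - ν.real (U k) * F (x k)| ≤ ε * ν.real (U k) := by
      intro k
      have e1 : ∫ a in U k, F a ∂ν - ν.real (U k) * F (x k) =
          ∫ a in U k, (F a - F (x k)) ∂ν := by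
        rw [integral_sub (hint k) (integrableOn_const (hUfin k)), setIntegral_const, smul_eq_mul]
      rw [e1]
      exact norm_setIntegral_le_of_norm_le_const (hUfin k).lt_top (hosc k)
    have hnorm : Summable fun k => ∫ a in U k, ‖F a‖ ∂ν := by
      refine Summable.of_nonneg_of_le (fun k => integral_nonneg fun _ => norm_nonneg _)
        (fun k => ?_) (hsum.abs.add (hνU.summable.mul_left ε))
      calc ∫ a in U k, ‖F a‖ ∂ν ≤ ∫ a in U k, (|F (x k)| + ε) ∂ν := by
            refine setIntegral_mono_on (hint k).norm (integrableOn_const (hUfin k))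
              (hU.measurable k) fun a ha => ?_
            have h1 := hosc k a ha
            have h2 := norm_sub_norm_le (F a) (F (x k))
            simp only [Real.norm_eq_abs] at *
            linarith
        _ = |ν.real (U k) * F (x k)| + ε * ν.real (U k) := by
            rw [setIntegral_const, smul_eq_mul, abs_mul, abs_of_nonneg measureReal_nonneg]
            ring
    have hI : IntegrableOn F (⋃ k, U k) ν :=
      integrableOn_iUnion_of_summable_integral_norm hint hnorm
    have hHas := hasSum_integral_iUnion hU.measurable hU.disjoint hI
    rw [hU.cover] at hI hHas
    refine ⟨hI, ?_⟩
    have h1 : |∫ a in A, F a ∂ν - ∑' k, ν.real (U k) * F (x k)| ≤ ε * ν.real A := by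
      have hs1 := hHas.sub hsum.hasSum
      have hs2 := hνU.mul_left ε
      rw [← hs1.tsum_eq]
      exact tsum_of_norm_bounded (f := fun k => ∫ a in U k, F a ∂ν - ν.real (U k) * F (x k)) hs2
        hdiff
    have h2 := abs_sub_le (∫ a in A, F a ∂ν) (∑' k, ν.real (U k) * F (x k)) I
    linarith
  refine ⟨(key 1 one_pos).1, ?_⟩
  have hm : 0 ≤ ν.real A := measureReal_nonneg
  refine sub_eq_zero.1 (abs_eq_zero.1 (le_antisymm (le_of_forall_pos_le_add fun ε hε => ?_)
    (abs_nonneg _)))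
  have := (key (ε / (ν.real A + 1)) (by positivity)).2
  rwa [div_mul_cancel₀ _ (by positivity), ← zero_add ε] at this

/-- A continuous functional of the Birkhoff integral over a part of `A` is the Lebesgue integral of
the functional of the integrand, if the latter is measurable. -/
lemma BirkhoffIntegrable.integrableOn_and_apply_birkhoffIntegral [Nonempty α] [CompleteSpace X]
    {Φ : α → X} {A B : Set α} {ν : Measure α} (h : BirkhoffIntegrable Φ A ν)
    (hB : MeasurableSet B) (hBA : B ⊆ A) (hνB : ν B ≠ ∞) (f : StrongDual ℝ X) {F : α → ℝ}
    (hF : Measurable F) (hfF : EqOn (fun a => f (Φ a)) F B) :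
    IntegrableOn F B ν ∧ f (birkhoffIntegral Φ B ν) = ∫ a in B, F a ∂ν := by
  have hint := h.mono hB hBA
  have hspec : HasBirkhoffIntegral Φ B ν (birkhoffIntegral Φ B ν) := by
    rw [birkhoffIntegral, dif_pos hint]
    exact hint.choose_spec
  obtain ⟨h1, h2⟩ := (((hasBirkhoffIntegral_iff.1 hspec).map f).congr
    hfF).integrableOn_and_setIntegral_eq hF hνB
  exact ⟨h1, h2.symm⟩

end Birkhoff

/-! ### Uniform partitions and step functions -/

section Partitions

/-- The points of the uniform partition of `[a, b]` into `n + 1` intervals. -/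
noncomputable def uniformPoint (a b : ℝ≥0) (n i : ℕ) : ℝ≥0 := a + (b - a) * (i / (n + 1))

lemma coe_uniformPoint {a b : ℝ≥0} (hab : a ≤ b) (n i : ℕ) :
    (uniformPoint a b n i : ℝ) = a + (b - a) * (i / (n + 1)) := by
  simp [uniformPoint, NNReal.coe_sub hab]

lemma uniformPoint_zero (a b : ℝ≥0) (n : ℕ) : uniformPoint a b n 0 = a := by
  simp [uniformPoint]

lemma uniformPoint_last {a b : ℝ≥0} (hab : a ≤ b) (n : ℕ) : uniformPoint a b n (n + 1) = b := by
  have h : ((n : ℝ≥0) + 1) ≠ 0 := by positivity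
  rw [uniformPoint, Nat.cast_add_one, div_self h, mul_one, add_tsub_cancel_of_le hab]

lemma monotone_uniformPoint (a b : ℝ≥0) (n : ℕ) : Monotone (uniformPoint a b n) := by
  intro i j hij
  unfold uniformPoint
  gcongr

lemma le_uniformPoint (a b : ℝ≥0) (n i : ℕ) : a ≤ uniformPoint a b n i :=
  le_self_add

lemma uniformPoint_le {a b : ℝ≥0} (hab : a ≤ b) {n i : ℕ} (hi : i ≤ n + 1) :
    uniformPoint a b n i ≤ b :=
  (monotone_uniformPoint a b n hi).trans (uniformPoint_last hab n).le

lemma Icc_uniformPoint_subset {a b : ℝ≥0} (hab : a ≤ b) {n i : ℕ} (hi : i < n + 1) :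
    Icc (uniformPoint a b n i : ℝ) (uniformPoint a b n (i + 1)) ⊆ Icc (a : ℝ) b :=
  Icc_subset_Icc (NNReal.coe_le_coe.2 (le_uniformPoint a b n i))
    (NNReal.coe_le_coe.2 (uniformPoint_le hab hi))

/-- The oscillation of a continuous function on the intervals of the uniform partitions tends
to `0`. -/
lemma eventually_osc_uniformPoint_le {a b : ℝ≥0} (hab : a ≤ b) {g : ℝ → ℝ}
    (hg : ContinuousOn g (Icc (a : ℝ) b)) {ε : ℝ} (hε : 0 < ε) :
    ∀ᶠ n : ℕ in atTop, ∀ i < n + 1,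
      ∀ x ∈ Icc (uniformPoint a b n i : ℝ) (uniformPoint a b n (i + 1)),
      ∀ y ∈ Icc (uniformPoint a b n i : ℝ) (uniformPoint a b n (i + 1)), |g x - g y| ≤ ε := by
  obtain ⟨δ, hδ, hgδ⟩ := Metric.uniformContinuousOn_iff.1
    (isCompact_Icc.uniformContinuousOn_of_continuous hg) ε hε
  have hlim : Tendsto (fun n : ℕ => ((b : ℝ) - a) * (1 / ((n : ℝ) + 1))) atTop (𝓝 0) := by
    simpa using tendsto_one_div_add_atTop_nhds_zero_nat.const_mul ((b : ℝ) - a)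
  filter_upwards [hlim.eventually (gt_mem_nhds hδ)] with n hn i hi x hx y hy
  have hsub := Icc_uniformPoint_subset hab hi
  refine (hgδ x (hsub hx) y (hsub hy) ?_).le
  refine (Real.dist_le_of_mem_Icc hx hy).trans_lt ?_
  rw [coe_uniformPoint hab, coe_uniformPoint hab]
  refine lt_of_eq_of_lt ?_ hn
  push_cast
  ring

lemma sum_indicator_Ioc {ι : Type*} [LinearOrder ι] {τ : ℕ → ι} (hτ : Monotone τ) (N : ℕ)
    (g : ι → ℝ) (s : ι) :
    ∑ i ∈ Finset.range N, (Ioc (τ i) (τ (i + 1))).indicator g s =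
      (Ioc (τ 0) (τ N)).indicator g s := by
  induction N with
  | zero => simp
  | succ N ih =>
    rw [Finset.sum_range_succ, ih, ← Ioc_union_Ioc_eq_Ioc (hτ N.zero_le) (hτ N.le_succ),
      indicator_union_of_disjoint]
    exact Set.disjoint_left.2 fun x hx hx' => not_lt.2 hx.2 hx'.1

lemma abs_sum_indicator_Ioc_sub_le {ι : Type*} [LinearOrder ι] {τ : ℕ → ι} (hτ : Monotone τ)
    {N : ℕ} {c : ℕ → ℝ} {g : ι → ℝ} {δ : ℝ} (hδ : 0 ≤ δ)
    (h : ∀ i < N, ∀ s ∈ Ioc (τ i) (τ (i + 1)), |c i - g s| ≤ δ) (s : ι) :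
    |∑ i ∈ Finset.range N, (Ioc (τ i) (τ (i + 1))).indicator (fun _ => c i) s -
      (Ioc (τ 0) (τ N)).indicator g s| ≤ δ := by
  rw [← sum_indicator_Ioc hτ, ← Finset.sum_sub_distrib]
  calc |∑ i ∈ Finset.range N, ((Ioc (τ i) (τ (i + 1))).indicator (fun _ => c i) s -
        (Ioc (τ i) (τ (i + 1))).indicator g s)|
      ≤ ∑ i ∈ Finset.range N, (Ioc (τ i) (τ (i + 1))).indicator (fun _ => δ) s := by
        refine (Finset.abs_sum_le_sum_abs _ _).trans (Finset.sum_le_sum fun i hi => ?_)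
        by_cases hs : s ∈ Ioc (τ i) (τ (i + 1))
        · simpa [hs] using h i (Finset.mem_range.1 hi) s hs
        · simp [hs]
    _ = (Ioc (τ 0) (τ N)).indicator (fun _ => δ) s := sum_indicator_Ioc hτ N _ s
    _ ≤ δ := indicator_le_self' (fun _ _ => hδ) s

/-! ### Pathwise integration by parts -/

/-- Summation by parts turns the left-point sums `∑ φ(τ i) (W(τ (i+1)) - W(τ i))` into
right-point sums for `∫ W dφ = ∫ W ψ`. -/
lemma tendsto_sum_mul_increment {a b : ℝ≥0} (hab : a ≤ b) {φ ψ W : ℝ → ℝ}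
    (hW : ContinuousOn W (Icc (a : ℝ) b)) (hφ : ContinuousOn φ (Icc (a : ℝ) b))
    (hφψ : ∀ s ∈ Ioo (a : ℝ) b, HasDerivAt φ (ψ s) s) (hψ : IntegrableOn ψ (Icc (a : ℝ) b)) :
    Tendsto (fun n : ℕ => ∑ i ∈ Finset.range (n + 1), φ (uniformPoint a b n i) *
      (W (uniformPoint a b n (i + 1)) - W (uniformPoint a b n i))) atTop
      (𝓝 (φ b * W b - φ a * W a - ∫ s in Icc (a : ℝ) b, W s * ψ s)) := by
  have hab' : (a : ℝ) ≤ b := hab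
  set K : ℝ := ∫ s in (a : ℝ)..b, |ψ s| with hKdef
  have hK : 0 ≤ K := intervalIntegral.integral_nonneg hab' fun _ _ => abs_nonneg _
  have hWψ : IntegrableOn (fun s => W s * ψ s) (Icc (a : ℝ) b) :=
    hψ.continuousOn_mul hW isCompact_Icc
  have hbound : ∀ ε : ℝ, 0 < ε → ∀ᶠ n : ℕ in atTop,
      |∑ i ∈ Finset.range (n + 1), φ (uniformPoint a b n i) *
        (W (uniformPoint a b n (i + 1)) - W (uniformPoint a b n i)) -
        (φ b * W b - φ a * W a - ∫ s in Icc (a : ℝ) b, W s * ψ s)| ≤ ε * K := by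
    intro ε hε
    filter_upwards [eventually_osc_uniformPoint_le hab hW hε] with n hn
    set τ : ℕ → ℝ := fun i => (uniformPoint a b n i : ℝ) with hτ
    have hτ0 : τ 0 = a := by simp [hτ, uniformPoint_zero]
    have hτn : τ (n + 1) = b := by simp only [hτ, uniformPoint_last hab]
    have hmono : ∀ i, τ i ≤ τ (i + 1) := fun i => monotone_uniformPoint a b n i.le_succ
    have hsub : ∀ i < n + 1, Icc (τ i) (τ (i + 1)) ⊆ Icc (a : ℝ) b := fun i hi =>
      Icc_uniformPoint_subset hab hi
    have hint : ∀ {F : ℝ → ℝ}, IntegrableOn F (Icc (a : ℝ) b) → ∀ i < n + 1,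
        IntervalIntegrable F volume (τ i) (τ (i + 1)) := fun hF i hi =>
      (intervalIntegrable_iff_integrableOn_Icc_of_le (hmono i)).2 (hF.mono_set (hsub i hi))
    have hsum : ∀ {F : ℝ → ℝ}, IntegrableOn F (Icc (a : ℝ) b) →
        ∫ s in (a : ℝ)..b, F s = ∑ i ∈ Finset.range (n + 1), ∫ s in τ i..τ (i + 1), F s := by
      intro F hF
      rw [intervalIntegral.sum_integral_adjacent_intervals fun i hi => hint hF i hi, hτ0, hτn]
    have hftc : ∀ i < n + 1, ∫ s in τ i..τ (i + 1), ψ s = φ (τ (i + 1)) - φ (τ i) := by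
      intro i hi
      refine intervalIntegral.integral_eq_sub_of_hasDerivAt_of_le (hmono i)
        (hφ.mono (hsub i hi)) (fun x hx => hφψ x ?_) (hint hψ i hi)
      exact ⟨(hsub i hi ⟨le_rfl, hmono i⟩).1.trans_lt hx.1,
        hx.2.trans_le (hsub i hi ⟨hmono i, le_rfl⟩).2⟩
    have habel : ∑ i ∈ Finset.range (n + 1), φ (τ i) * (W (τ (i + 1)) - W (τ i)) =
        φ b * W b - φ a * W a -
          ∑ i ∈ Finset.range (n + 1), W (τ (i + 1)) * (φ (τ (i + 1)) - φ (τ i)) := by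
      rw [eq_sub_iff_add_eq, ← Finset.sum_add_distrib, ← hτ0, ← hτn,
        ← Finset.sum_range_sub (fun i => φ (τ i) * W (τ i))]
      exact Finset.sum_congr rfl fun i _ => by ring
    have hdiff : ∑ i ∈ Finset.range (n + 1), φ (τ i) * (W (τ (i + 1)) - W (τ i)) -
        (φ b * W b - φ a * W a - ∫ s in Icc (a : ℝ) b, W s * ψ s) =
        ∑ i ∈ Finset.range (n + 1), ∫ s in τ i..τ (i + 1), (W s - W (τ (i + 1))) * ψ s := by
      rw [habel, integral_Icc_eq_integral_Ioc, ← intervalIntegral.integral_of_le hab', hsum hWψ,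
        sub_sub_sub_cancel_left, ← Finset.sum_sub_distrib]
      refine Finset.sum_congr rfl fun i hi => ?_
      have hi' := Finset.mem_range.1 hi
      rw [← hftc i hi', ← intervalIntegral.integral_const_mul,
        ← intervalIntegral.integral_sub (hint hWψ i hi') ((hint hψ i hi').const_mul _)]
      exact intervalIntegral.integral_congr fun s _ => by ring
    rw [hdiff, hKdef, hsum hψ.abs, Finset.mul_sum]
    refine (Finset.abs_sum_le_sum_abs _ _).trans (Finset.sum_le_sum fun i hi => ?_)
    have hi' := Finset.mem_range.1 hi
    rw [← intervalIntegral.integral_const_mul, ← Real.norm_eq_abs]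
    refine intervalIntegral.norm_integral_le_of_norm_le (hmono i) (ae_of_all _ fun s hs => ?_)
      ((hint hψ.abs i hi').const_mul _)
    rw [norm_mul, Real.norm_eq_abs, Real.norm_eq_abs]
    gcongr
    exact hn i hi' s ⟨hs.1.le, hs.2⟩ _ ⟨hmono i, le_rfl⟩
  rw [Metric.tendsto_atTop']
  intro ε hε
  obtain ⟨N, hN⟩ := eventually_atTop.1 (hbound (ε / (K + 1)) (by positivity))
  refine ⟨N, fun n hn => ?_⟩
  rw [Real.dist_eq]
  refine (hN n hn.le).trans_lt ?_
  rw [div_mul_eq_mul_div, div_lt_iff₀ (by positivity)]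
  nlinarith

end Partitions

/-! ### The graph of the Wiener integral -/

section Graph

variable {Ω : Type*} {mΩ : MeasurableSpace Ω} {P : Measure Ω} {𝓕 : Filtration ℝ≥0 mΩ} {T : ℝ≥0}
  {w : ℝ≥0 → Ω → ℝ}

/-- If corresponding vectors in two inner product spaces have the same Gram matrix, then the
closed span of the pairs is the graph of an isometry. -/
lemma norm_fst_eq_norm_snd_of_inner_eq {E F : Type*} [NormedAddCommGroup E] [InnerProductSpace ℝ E]
    [NormedAddCommGroup F] [InnerProductSpace ℝ F] {S : Set (E × F)}
    (hS : ∀ p ∈ S, ∀ q ∈ S, inner ℝ p.1 q.1 = inner ℝ p.2 q.2) {p : E × F}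
    (hp : p ∈ (Submodule.span ℝ S).topologicalClosure) : ‖p.1‖ = ‖p.2‖ := by
  let L : E × F → (E × F) →L[ℝ] ℝ := fun p =>
    (innerSL ℝ p.1).comp (ContinuousLinearMap.fst ℝ E F) -
      (innerSL ℝ p.2).comp (ContinuousLinearMap.snd ℝ E F)
  have hL : ∀ p q, L p q = inner ℝ p.1 q.1 - inner ℝ p.2 q.2 := fun p q => by simp [L]
  have hmin : ∀ p, (∀ q ∈ S, L p q = 0) →
      ∀ q ∈ (Submodule.span ℝ S).topologicalClosure, L p q = 0 := by
    intro p hp q hq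
    have h1 : (Submodule.span ℝ S).topologicalClosure ≤ (L p).ker :=
      Submodule.topologicalClosure_minimal _
        (Submodule.span_le.2 fun q hq => LinearMap.mem_ker.2 (hp q hq)) (L p).isClosed_ker
    exact LinearMap.mem_ker.1 (h1 hq)
  have hsymm : ∀ p q, L p q = L q p := fun p q => by
    rw [hL, hL, real_inner_comm, real_inner_comm p.2]
  have h1 : ∀ q ∈ S, L p q = 0 := fun q hq => by
    rw [hsymm]
    exact hmin q (fun r hr => by rw [hL, hS q hq r hr, sub_self]) p hp
  have h2 := hmin p h1 p hp
  rw [hL, real_inner_self_eq_norm_sq, real_inner_self_eq_norm_sq, sub_eq_zero] at h2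
  exact (sq_eq_sq₀ (norm_nonneg _) (norm_nonneg _)).1 h2

lemma IsBrownianMotion.memLp_sub (hw : IsBrownianMotion 𝓕 P T w) {s t : ℝ≥0} (hst : s ≤ t)
    (ht : t ≤ T) : MemLp (fun ω => w t ω - w s ω) 2 P := by
  have h := hw.law s t hst ht
  have h1 : MemLp id 2 (P.map fun ω => w t ω - w s ω) := by
    rw [h.map_eq]
    exact memLp_id_gaussianReal' 2 (by simp)
  exact (memLp_map_measure_iff h1.1 h.aemeasurable).1 h1

lemma IsBrownianMotion.integral_sub (hw : IsBrownianMotion 𝓕 P T w) {s t : ℝ≥0} (hst : s ≤ t)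
    (ht : t ≤ T) : ∫ ω, (w t ω - w s ω) ∂P = 0 := by
  rw [(hw.law s t hst ht).integral_eq, integral_id_gaussianReal]

lemma IsBrownianMotion.integral_sub_sq (hw : IsBrownianMotion 𝓕 P T w) {s t : ℝ≥0} (hst : s ≤ t)
    (ht : t ≤ T) : ∫ ω, (w t ω - w s ω) ^ 2 ∂P = t - s := by
  have h := hw.law s t hst ht
  have h1 := h.variance_eq
  rw [variance_of_integral_eq_zero h.aemeasurable (hw.integral_sub hst ht),
    variance_id_gaussianReal, NNReal.coe_sub hst] at h1
  exact h1

lemma IsBrownianMotion.integral_mul [IsProbabilityMeasure P] (hw : IsBrownianMotion 𝓕 P T w)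
    {u v : ℝ≥0} (huv : u ≤ v) (hv : v ≤ T) :
    ∫ ω, (w u ω - w 0 ω) * (w v ω - w 0 ω) ∂P = u := by
  have hu : u ≤ T := huv.trans hv
  have hWu := hw.memLp_sub zero_le hu
  have hWuv := hw.memLp_sub huv hv
  have hmeas : Measurable[𝓕 u] fun ω => w u ω - w 0 ω :=
    (hw.adapted u hu).sub ((hw.adapted 0 zero_le).mono (𝓕.mono zero_le) le_rfl)
  have hindep : IndepFun (fun ω => w u ω - w 0 ω) (fun ω => w v ω - w u ω) P :=
    indep_of_indep_of_le_left (hw.indep u v huv hv) hmeas.comap_le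
  have e : (fun ω => (w u ω - w 0 ω) * (w v ω - w 0 ω)) = fun ω =>
      (w u ω - w 0 ω) ^ 2 + (w u ω - w 0 ω) * (w v ω - w u ω) := by
    funext ω
    ring
  have hint : Integrable (fun ω => (w u ω - w 0 ω) * (w v ω - w u ω)) P :=
    hWu.integrable_mul hWuv
  rw [e, integral_add hWu.integrable_sq hint,
    hw.integral_sub_sq zero_le hu,
    hindep.integral_fun_mul_eq_mul_integral hWu.1 hWuv.1, hw.integral_sub huv hv]
  simp

/-- The graph of the Wiener integral `L²([0, T]) → L²(P)`: the closed span of the pairs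
`(1_(0, u], w_u - w_0)`. -/
noncomputable def wienerGraph (P : Measure Ω) (T : ℝ≥0) (w : ℝ≥0 → Ω → ℝ) :
    Submodule ℝ (Lp ℝ 2 (volume.restrict (Icc 0 (T : ℝ))) × Lp ℝ 2 P) :=
  (Submodule.span ℝ {p | ∃ u ≤ T,
    p.1 =ᵐ[volume.restrict (Icc 0 (T : ℝ))] (Ioc (0 : ℝ) u).indicator 1 ∧
    p.2 =ᵐ[P] fun ω => w u ω - w 0 ω}).topologicalClosure

/-- The isometry of the Wiener integral; the Gram matrices both consist of the `min u v`. -/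
lemma IsBrownianMotion.norm_fst_eq_norm_snd [IsProbabilityMeasure P]
    (hw : IsBrownianMotion 𝓕 P T w)
    {p : Lp ℝ 2 (volume.restrict (Icc 0 (T : ℝ))) × Lp ℝ 2 P} (hp : p ∈ wienerGraph P T w) :
    ‖p.1‖ = ‖p.2‖ := by
  refine norm_fst_eq_norm_snd_of_inner_eq ?_ hp
  have key : ∀ u v : ℝ≥0, u ≤ v → v ≤ T →
      ∀ p q : Lp ℝ 2 (volume.restrict (Icc 0 (T : ℝ))) × Lp ℝ 2 P,
      p.1 =ᵐ[volume.restrict (Icc 0 (T : ℝ))] (Ioc (0 : ℝ) u).indicator 1 →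
      p.2 =ᵐ[P] (fun ω => w u ω - w 0 ω) →
      q.1 =ᵐ[volume.restrict (Icc 0 (T : ℝ))] (Ioc (0 : ℝ) v).indicator 1 →
      q.2 =ᵐ[P] (fun ω => w v ω - w 0 ω) → inner ℝ p.1 q.1 = inner ℝ p.2 q.2 := by
    intro u v huv hv p q hp1 hp2 hq1 hq2
    have h1 : inner ℝ p.1 q.1 = (u : ℝ) := by
      rw [L2.inner_def]
      have : (fun a => inner ℝ (p.1 a) (q.1 a)) =ᵐ[volume.restrict (Icc 0 (T : ℝ))]
          (Ioc (0 : ℝ) u).indicator 1 := by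
        filter_upwards [hp1, hq1] with s h1 h2
        rw [h1, h2]
        by_cases hs : s ∈ Ioc (0 : ℝ) u
        · have hs' : s ∈ Ioc (0 : ℝ) v := ⟨hs.1, hs.2.trans huv⟩
          simp [hs, hs']
        · simp [hs]
      rw [integral_congr_ae this, integral_indicator_one measurableSet_Ioc, measureReal_def,
        Measure.restrict_apply measurableSet_Ioc, inter_eq_left.2, Real.volume_Ioc]
      · simp
      · exact fun s hs => ⟨hs.1.le, hs.2.trans (huv.trans hv)⟩
    have h2 : inner ℝ p.2 q.2 = (u : ℝ) := by
      rw [L2.inner_def, ← hw.integral_mul huv hv]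
      refine integral_congr_ae ?_
      filter_upwards [hp2, hq2] with ω h1 h2
      rw [h1, h2, real_inner_eq_re_inner]
      simp [mul_comm]
    rw [h1, h2]
  rintro p ⟨u, hu, hp1, hp2⟩ q ⟨v, hv, hq1, hq2⟩
  rcases le_total u v with h | h
  · exact key u v h hv p q hp1 hp2 hq1 hq2
  · rw [real_inner_comm, real_inner_comm q.2]
    exact key v u h hu q p hq1 hq2 hp1 hp2

lemma IsBrownianMotion.exists_mem_wienerGraph_Ioc (hw : IsBrownianMotion 𝓕 P T w) {a b : ℝ≥0}
    (hab : a ≤ b) (hb : b ≤ T) : ∃ p ∈ wienerGraph P T w,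
      p.1 =ᵐ[volume.restrict (Icc 0 (T : ℝ))] (Ioc (a : ℝ) b).indicator 1 ∧
      p.2 =ᵐ[P] fun ω => w b ω - w a ω := by
  have key : ∀ u ≤ T, ∃ p ∈ wienerGraph P T w,
      p.1 =ᵐ[volume.restrict (Icc 0 (T : ℝ))] (Ioc (0 : ℝ) u).indicator 1 ∧
      p.2 =ᵐ[P] fun ω => w u ω - w 0 ω := by
    intro u hu
    have h1 : MemLp ((Ioc (0 : ℝ) u).indicator (1 : ℝ → ℝ)) 2 (volume.restrict (Icc 0 (T : ℝ))) :=
      (memLp_const 1).indicator measurableSet_Ioc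
    have h2 := hw.memLp_sub zero_le hu
    exact ⟨(h1.toLp _, h2.toLp _), Submodule.le_topologicalClosure _
      (Submodule.subset_span ⟨u, hu, h1.coeFn_toLp, h2.coeFn_toLp⟩), h1.coeFn_toLp, h2.coeFn_toLp⟩
  obtain ⟨p, hp, hp1, hp2⟩ := key a (hab.trans hb)
  obtain ⟨q, hq, hq1, hq2⟩ := key b hb
  refine ⟨q - p, Submodule.sub_mem _ hq hp, ?_, ?_⟩
  · filter_upwards [Lp.coeFn_sub q.1 p.1, hp1, hq1] with s h h1 h2
    rw [Prod.fst_sub, h, Pi.sub_apply, h1, h2, sub_eq_iff_eq_add, add_comm,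
      ← Ioc_union_Ioc_eq_Ioc a.coe_nonneg (NNReal.coe_le_coe.2 hab), indicator_union_of_disjoint]
    exact Set.disjoint_left.2 fun x hx hx' => not_lt.2 hx.2 hx'.1
  · filter_upwards [Lp.coeFn_sub q.2 p.2, hp2, hq2] with ω h h1 h2
    rw [Prod.snd_sub, h, Pi.sub_apply, h1, h2]
    ring

lemma IsBrownianMotion.exists_mem_wienerGraph_sum (hw : IsBrownianMotion 𝓕 P T w) {τ : ℕ → ℝ≥0}
    (hτ : Monotone τ) (N : ℕ) (hN : τ N ≤ T) (c : ℕ → ℝ) : ∃ p ∈ wienerGraph P T w,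
      p.1 =ᵐ[volume.restrict (Icc 0 (T : ℝ))] (fun s => ∑ i ∈ Finset.range N,
        (Ioc (τ i : ℝ) (τ (i + 1))).indicator (fun _ => c i) s) ∧
      p.2 =ᵐ[P] fun ω => ∑ i ∈ Finset.range N, c i * (w (τ (i + 1)) ω - w (τ i) ω) := by
  induction N with
  | zero =>
    refine ⟨0, Submodule.zero_mem _, ?_, ?_⟩
    · simp only [Finset.range_zero, Finset.sum_empty]
      exact Lp.coeFn_zero ℝ 2 _
    · simp only [Finset.range_zero, Finset.sum_empty]
      exact Lp.coeFn_zero ℝ 2 P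
  | succ N ih =>
    obtain ⟨p, hp, hp1, hp2⟩ := ih ((hτ N.le_succ).trans hN)
    obtain ⟨q, hq, hq1, hq2⟩ := hw.exists_mem_wienerGraph_Ioc (hτ N.le_succ) hN
    refine ⟨p + c N • q, Submodule.add_mem _ hp (Submodule.smul_mem _ _ hq), ?_, ?_⟩
    · filter_upwards [Lp.coeFn_add p.1 (c N • q.1), Lp.coeFn_smul (c N) q.1, hp1, hq1]
        with s h h' h1 h2
      rw [Prod.fst_add, Prod.smul_fst, h, Pi.add_apply, h', Pi.smul_apply, h1, h2,
        Finset.sum_range_succ]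
      by_cases hs : s ∈ Ioc (τ N : ℝ) (τ (N + 1)) <;> simp [hs]
    · filter_upwards [Lp.coeFn_add p.2 (c N • q.2), Lp.coeFn_smul (c N) q.2, hp2, hq2]
        with ω h h' h1 h2
      rw [Prod.snd_add, Prod.smul_snd, h, Pi.add_apply, h', Pi.smul_apply, h1, h2,
        Finset.sum_range_succ, smul_eq_mul]

/-- By the isometry, convergence of the integrands in `L²` gives convergence of the Wiener
integrals in `L²(P)`. -/
lemma IsBrownianMotion.exists_mem_wienerGraph_of_tendsto [IsProbabilityMeasure P]
    (hw : IsBrownianMotion 𝓕 P T w)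
    {p : ℕ → Lp ℝ 2 (volume.restrict (Icc 0 (T : ℝ))) × Lp ℝ 2 P}
    (hp : ∀ n, p n ∈ wienerGraph P T w) {h : Lp ℝ 2 (volume.restrict (Icc 0 (T : ℝ)))}
    (hlim : Tendsto (fun n => (p n).1) atTop (𝓝 h)) :
    ∃ q ∈ wienerGraph P T w, q.1 = h ∧ Tendsto (fun n => (p n).2) atTop (𝓝 q.2) := by
  have hdist : ∀ m n, dist (p m).2 (p n).2 = dist (p m).1 (p n).1 := fun m n => by
    rw [dist_eq_norm, dist_eq_norm]
    exact (hw.norm_fst_eq_norm_snd (Submodule.sub_mem _ (hp m) (hp n))).symm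
  have hcauchy : CauchySeq fun n => (p n).2 := by
    rw [Metric.cauchySeq_iff]
    simp only [hdist]
    exact Metric.cauchySeq_iff.1 hlim.cauchySeq
  obtain ⟨Z, hZ⟩ := cauchySeq_tendsto_of_complete hcauchy
  exact ⟨(h, Z), (Submodule.isClosed_topologicalClosure _).mem_of_tendsto (hlim.prodMk_nhds hZ)
    (Eventually.of_forall hp), rfl, hZ⟩

lemma ae_eq_of_tendsto_Lp_of_tendsto_ae [IsFiniteMeasure P] {Z : ℕ → Lp ℝ 2 P} {Z' : Lp ℝ 2 P}
    {Y : Ω → ℝ} (hZ : Tendsto Z atTop (𝓝 Z'))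
    (hY : ∀ᵐ ω ∂P, Tendsto (fun n => Z n ω) atTop (𝓝 (Y ω))) : Z' =ᵐ[P] Y :=
  tendstoInMeasure_ae_unique (tendstoInMeasure_of_tendsto_Lp hZ)
    (tendstoInMeasure_of_tendsto_ae (fun n => Lp.aestronglyMeasurable (Z n)) hY)

end Graph

/-! ### Deterministic integrands -/

section Deterministic

variable {Ω : Type*} {mΩ : MeasurableSpace Ω} {P : Measure Ω} [IsProbabilityMeasure P]
  {𝓕 : Filtration ℝ≥0 mΩ} {T : ℝ≥0} {w : ℝ≥0 → Ω → ℝ}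

/-- The Wiener integral of a continuous function over `(a, b]` is the `L²`-limit of the left-point
sums over uniform partitions. -/
lemma IsBrownianMotion.exists_mem_wienerGraph_leftSum (hw : IsBrownianMotion 𝓕 P T w) {φ : ℝ → ℝ}
    {a b : ℝ≥0} (hab : a ≤ b) (hb : b ≤ T) (hφ : ContinuousOn φ (Icc (a : ℝ) b))
    {h : Lp ℝ 2 (volume.restrict (Icc 0 (T : ℝ)))}
    (hh : h =ᵐ[volume.restrict (Icc 0 (T : ℝ))] (Ioc (a : ℝ) b).indicator φ) :
    ∃ J : ℕ → Lp ℝ 2 P, (∀ n, J n =ᵐ[P] fun ω => ∑ i ∈ Finset.range (n + 1),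
        φ (uniformPoint a b n i) *
          (w (uniformPoint a b n (i + 1)) ω - w (uniformPoint a b n i) ω)) ∧
      ∃ q ∈ wienerGraph P T w, q.1 = h ∧ Tendsto J atTop (𝓝 q.2) := by
  choose p hp hp1 hp2 using fun n : ℕ => hw.exists_mem_wienerGraph_sum
    (monotone_uniformPoint a b n) (n + 1) ((uniformPoint_last hab n).trans_le hb)
    (fun i => φ (uniformPoint a b n i))
  refine ⟨fun n => (p n).2, hp2, hw.exists_mem_wienerGraph_of_tendsto hp ?_⟩
  set M : ℝ := (measureUnivNNReal (volume.restrict (Icc 0 (T : ℝ))) : ℝ) ^ (2 : ℝ≥0∞).toReal⁻¹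
  have hM : 0 ≤ M := by positivity
  rw [Metric.tendsto_atTop']
  intro ε hε
  have hε' : 0 < ε / (M + 1) := by positivity
  obtain ⟨N, hN⟩ := eventually_atTop.1 (eventually_osc_uniformPoint_le hab hφ hε')
  refine ⟨N, fun n hn => ?_⟩
  have hbound : ‖(p n).1 - h‖ ≤ M * (ε / (M + 1)) := by
    refine Lp.norm_le_of_ae_bound hε'.le ?_
    filter_upwards [Lp.coeFn_sub (p n).1 h, hp1 n, hh] with s h1 h2 h3
    rw [h1, Pi.sub_apply, h2, h3, Real.norm_eq_abs]
    have hmono : Monotone fun i => (uniformPoint a b n i : ℝ) := fun i j hij =>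
      monotone_uniformPoint a b n hij
    have := abs_sum_indicator_Ioc_sub_le hmono (N := n + 1)
      (c := fun i => φ (uniformPoint a b n i)) (g := φ) hε'.le (fun i hi s hs =>
        hN n hn.le i hi _ ⟨le_rfl, hmono i.le_succ⟩ s ⟨hs.1.le, hs.2⟩) s
    simpa only [uniformPoint_zero, uniformPoint_last hab] using this
  rw [dist_eq_norm]
  refine hbound.trans_lt ?_
  rw [mul_div_assoc', div_lt_iff₀ (by positivity)]
  nlinarith

/-- The simple process with the left-point values of `φ` on the uniform partition of `[0, t]`. -/
noncomputable def leftPointProcess (𝓕 : Filtration ℝ≥0 mΩ) (φ : ℝ → ℝ) (t : ℝ≥0) (n : ℕ) :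
    SimpleProcess 𝓕 where
  n := n + 1
  τ := uniformPoint 0 t n
  ξ i _ := φ (uniformPoint 0 t n i)
  mono := monotone_uniformPoint 0 t n
  measurable _ := measurable_const
  bounded i := ⟨|φ (uniformPoint 0 t n i)|, fun _ => le_rfl⟩

lemma leftPointProcess_integral (φ : ℝ → ℝ) (t : ℝ≥0) (n : ℕ) (ω : Ω) :
    (leftPointProcess 𝓕 φ t n).integral w t ω = ∑ i ∈ Finset.range (n + 1),
      φ (uniformPoint 0 t n i) *
        (w (uniformPoint 0 t n (i + 1)) ω - w (uniformPoint 0 t n i) ω) := by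
  refine Finset.sum_congr rfl fun i hi => ?_
  have hi' := Finset.mem_range.1 hi
  simp only [leftPointProcess]
  rw [min_eq_left (uniformPoint_le zero_le hi'), min_eq_left (uniformPoint_le zero_le hi'.le)]

lemma tendsto_leftPointProcess_eval {φ : ℝ → ℝ} {t : ℝ≥0} (hφ : ContinuousOn φ (Icc 0 (t : ℝ))) :
    Tendsto (fun n => ∫⁻ ω, (∫⁻ s in Icc 0 (t : ℝ),
      ‖(leftPointProcess 𝓕 φ t n).eval s.toNNReal ω - φ (s.toNNReal : ℝ)‖ₑ ^ 2) ∂P)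
      atTop (𝓝 0) := by
  have hlim : Tendsto (fun δ : ℝ => ENNReal.ofReal (δ ^ 2 * t)) (𝓝[>] 0) (𝓝 0) := by
    have h1 : Tendsto (fun δ : ℝ => ENNReal.ofReal (δ ^ 2 * t)) (𝓝 0)
        (𝓝 (ENNReal.ofReal ((0 : ℝ) ^ 2 * t))) :=
      (ENNReal.continuous_ofReal.comp (by fun_prop)).tendsto 0
    simp only [ne_eq, OfNat.ofNat_ne_zero, not_false_eq_true, zero_pow, zero_mul,
      ENNReal.ofReal_zero] at h1
    exact h1.mono_left nhdsWithin_le_nhds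
  rw [ENNReal.tendsto_nhds_zero]
  intro ε hε
  obtain ⟨δ, hδε, hδ⟩ := ((ENNReal.tendsto_nhds_zero.1 hlim ε hε).and self_mem_nhdsWithin).exists
  have hδ : 0 < δ := hδ
  have hφ' : ContinuousOn φ (Icc ((0 : ℝ≥0) : ℝ) t) := by simpa using hφ
  filter_upwards [eventually_osc_uniformPoint_le zero_le hφ' hδ] with n hn
  refine le_trans ?_ hδε
  have hmono := monotone_uniformPoint 0 t n
  have hpt : ∀ ω : Ω, ∀ s ∈ Ioc 0 (t : ℝ),
      ‖(leftPointProcess 𝓕 φ t n).eval s.toNNReal ω - φ (s.toNNReal : ℝ)‖ₑ ^ 2 ≤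
        ENNReal.ofReal (δ ^ 2) := by
    intro ω s hs
    have h1 := abs_sum_indicator_Ioc_sub_le hmono (N := n + 1)
      (c := fun i => φ (uniformPoint 0 t n i)) (g := fun s : ℝ≥0 => φ s) hδ.le (fun i hi s hs =>
        hn i hi _ ⟨le_rfl, hmono i.le_succ⟩ s
          ⟨NNReal.coe_le_coe.2 hs.1.le, NNReal.coe_le_coe.2 hs.2⟩) s.toNNReal
    have hmem : s.toNNReal ∈ Ioc 0 t :=
      ⟨Real.toNNReal_pos.2 hs.1, Real.toNNReal_le_iff_le_coe.2 hs.2⟩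
    rw [uniformPoint_zero, uniformPoint_last zero_le, indicator_of_mem hmem] at h1
    rw [ENNReal.ofReal_pow hδ.le, ← ofReal_norm]
    gcongr
    exact h1
  calc ∫⁻ ω, (∫⁻ s in Icc 0 (t : ℝ),
      ‖(leftPointProcess 𝓕 φ t n).eval s.toNNReal ω - φ (s.toNNReal : ℝ)‖ₑ ^ 2) ∂P
      ≤ ∫⁻ _, ENNReal.ofReal (δ ^ 2 * t) ∂P := by
        refine lintegral_mono fun ω => ?_
        rw [← Measure.restrict_congr_set (Ioc_ae_eq_Icc (μ := volume))]
        refine (setLIntegral_mono measurable_const (hpt ω)).trans_eq ?_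
        rw [setLIntegral_const, Real.volume_Ioc, sub_zero, ENNReal.ofReal_mul (sq_nonneg δ)]
    _ = ENNReal.ofReal (δ ^ 2 * t) := by simp

/-- A function that becomes integrable after multiplication by almost every Brownian path is
integrable away from `0`, since for each `r > 0` some admissible path does not vanish at `r`.
It need not be integrable near `0`. -/
lemma IsBrownianMotion.integrableOn_of_ae_integrableOn_mul (hw : IsBrownianMotion 𝓕 P T w)
    {ψ : ℝ → ℝ} (hψ : Measurable ψ)
    (hint : ∀ᵐ ω ∂P, IntegrableOn (fun s => w s.toNNReal ω * ψ s) (Icc 0 (T : ℝ)))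
    {a b : ℝ≥0} (ha : 0 < a) (hb : b ≤ T) : IntegrableOn ψ (Icc (a : ℝ) b) := by
  refine LocallyIntegrableOn.integrableOn_isCompact (fun r hr => ?_) isCompact_Icc
  have hsub : Icc (a : ℝ) b ⊆ Icc 0 (T : ℝ) := Icc_subset_Icc a.coe_nonneg hb
  lift r to ℝ≥0 using (hsub hr).1
  have hr0 : 0 < r := ha.trans_le hr.1
  have hrT : r ≤ T := (hsub hr).2
  have hne : ∀ᵐ ω ∂P, w r ω - w 0 ω ≠ 0 := by
    have hv : r - 0 ≠ 0 := by simpa using hr0.ne'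
    have := nullSingletonClass_gaussianReal (μ := 0) hv
    rw [(hw.law 0 r zero_le hrT).ae_iff (p := fun x => x ≠ 0)
      (measurableSet_singleton (0 : ℝ)).compl.mem]
    exact compl_mem_ae_iff.2 (measure_singleton 0)
  obtain ⟨ω, h1, h2, h3, h4⟩ := (hw.zero.and (hne.and (hint.and hw.continuous))).exists
  rw [h1, sub_zero] at h2
  have hcont : ContinuousOn (fun s : ℝ => |w s.toNNReal ω|) (Icc 0 (T : ℝ)) :=
    (h4.comp continuous_real_toNNReal.continuousOn fun s hs =>
      ⟨zero_le, Real.toNNReal_le_iff_le_coe.2 hs.2⟩).abs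
  set c : ℝ := |w r ω| / 2 with hc
  have hcpos : 0 < c := by positivity
  have hev : {s : ℝ | c < |w s.toNNReal ω|} ∈ 𝓝[Icc 0 (T : ℝ)] (r : ℝ) := by
    refine (hcont r (hsub hr)).eventually (lt_mem_nhds ?_)
    simp only [Real.toNNReal_coe, hc]
    exact half_lt_self (by positivity)
  obtain ⟨O, hO, hrO, hOsub⟩ := mem_nhdsWithin.1 hev
  refine ⟨O ∩ Icc (a : ℝ) b, inter_mem (mem_nhdsWithin_of_mem_nhds (hO.mem_nhds hrO))
    self_mem_nhdsWithin, ?_⟩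
  have hmeas : MeasurableSet (O ∩ Icc (a : ℝ) b) := hO.measurableSet.inter measurableSet_Icc
  refine Integrable.mono' (((h3.mono_set (inter_subset_right.trans hsub)).norm).const_mul c⁻¹)
    hψ.aestronglyMeasurable ((ae_restrict_iff' hmeas).2 (ae_of_all _ fun s hs => ?_))
  have h5 : c < |w s.toNNReal ω| := hOsub ⟨hs.1, hsub hs.2⟩
  rw [norm_mul, Real.norm_eq_abs, Real.norm_eq_abs, ← mul_assoc]
  refine le_mul_of_one_le_left (abs_nonneg _) ?_
  rw [← div_eq_inv_mul, one_le_div hcpos]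
  exact h5.le

/-- The indicators of `(aₙ, t]`, `aₙ → 0`, cut out functions converging in `L²`. -/
lemma tendsto_toLp_indicator_Ioc {φ : ℝ → ℝ} {T : ℝ≥0}
    (hφ : MemLp φ 2 (volume.restrict (Icc 0 (T : ℝ)))) {t : ℝ≥0} {a : ℕ → ℝ≥0}
    (hat : ∀ n, a n ≤ t) (ha : Tendsto a atTop (𝓝 0)) :
    Tendsto (fun n => (hφ.indicator (measurableSet_Ioc (a := (a n : ℝ)) (b := (t : ℝ)))).toLp _)
      atTop (𝓝 ((hφ.indicator (measurableSet_Ioc (a := (0 : ℝ)) (b := (t : ℝ)))).toLp _)) := by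
  refine (Lp.tendsto_Lp_iff_tendsto_eLpNorm'' _ _ _ _).2 ?_
  rw [ENNReal.tendsto_nhds_zero]
  intro ε hε
  obtain ⟨ε', hε', hεε⟩ : ∃ ε' : ℝ, 0 < ε' ∧ ENNReal.ofReal ε' ≤ ε := by
    obtain ⟨r, hr, hrε⟩ := ENNReal.lt_iff_exists_nnreal_btwn.1 hε
    exact ⟨r, by exact_mod_cast hr, by simpa using hrε.le⟩
  obtain ⟨δ, hδ, h⟩ := hφ.eLpNorm_indicator_le one_le_two (by simp) hε'
  have ha' : Tendsto (fun n => (a n : ℝ)) atTop (𝓝 0) :=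
    NNReal.tendsto_coe.2 ha
  filter_upwards [ha'.eventually (gt_mem_nhds hδ)] with n hn
  have e : (Ioc (a n : ℝ) t).indicator φ - (Ioc (0 : ℝ) t).indicator φ =
      -(Ioc (0 : ℝ) (a n)).indicator φ := by
    rw [sub_eq_iff_eq_add, ← Ioc_union_Ioc_eq_Ioc (a n).coe_nonneg (NNReal.coe_le_coe.2 (hat n)),
      indicator_union_of_disjoint]
    · funext s
      simp
    · exact Set.disjoint_left.2 fun x hx hx' => not_lt.2 hx.2 hx'.1
  rw [e, eLpNorm_neg]
  refine (h _ measurableSet_Ioc ((Measure.restrict_apply_le _ _).trans ?_)).trans hεε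
  rw [Real.volume_Ioc, sub_zero]
  exact ENNReal.ofReal_le_ofReal hn.le

/-- Integration by parts identifies the Itô integral of a deterministic differentiable `φ`. The
formula holds over `[t / (m + 1), t]`, where the derivative is integrable, and passes to the limit
`m → ∞` pathwise and, by the isometry, in `L²`. -/
lemma IsBrownianMotion.hasItoIntegral_deterministic (hw : IsBrownianMotion 𝓕 P T w)
    {φ ψ : ℝ → ℝ} (hφL : MemLp φ 2 (volume.restrict (Icc 0 (T : ℝ))))
    (hφ : ContinuousOn φ (Icc 0 (T : ℝ))) (hφψ : ∀ s ∈ Ioo 0 (T : ℝ), HasDerivAt φ (ψ s) s)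
    (hψ : Measurable ψ)
    (hint : ∀ᵐ ω ∂P, IntegrableOn (fun s => w s.toNNReal ω * ψ s) (Icc 0 (T : ℝ)))
    {t : ℝ≥0} (ht : t ≤ T) {Y : Ω → ℝ}
    (hY : ∀ᵐ ω ∂P, Y ω = φ t * w t ω - φ 0 * w 0 ω -
      ∫ s in Icc 0 (t : ℝ), w s.toNNReal ω * ψ s) :
    HasItoIntegral 𝓕 P w (fun s _ => φ s) t Y := by
  let a : ℕ → ℝ≥0 := fun m => t * (1 / ((m : ℝ≥0) + 1))
  have hat : ∀ m, a m ≤ t := fun m => by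
    refine mul_le_of_le_one_right zero_le ?_
    rw [div_le_one (by positivity)]
    exact le_add_self
  have ha : Tendsto a atTop (𝓝 0) := by
    have h1 : Tendsto (fun m : ℕ => 1 / ((m : ℝ≥0) + 1)) atTop (𝓝 0) := by
      rw [← NNReal.tendsto_coe]
      simpa using tendsto_one_div_add_atTop_nhds_zero_nat (𝕜 := ℝ)
    simpa [a] using h1.const_mul t
  have hsub : ∀ {c : ℝ≥0}, Icc (c : ℝ) t ⊆ Icc 0 (T : ℝ) := fun {c} =>
    Icc_subset_Icc c.coe_nonneg ht
  have hψa : ∀ m, IntegrableOn ψ (Icc (a m : ℝ) t) := by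
    intro m
    rcases eq_zero_or_pos t with rfl | htpos
    · have : Icc (a m : ℝ) (0 : ℝ≥0) = {0} := by simp [a]
      rw [this]
      simp
    · exact hw.integrableOn_of_ae_integrableOn_mul hψ hint (by positivity) ht
  set h : Lp ℝ 2 (volume.restrict (Icc 0 (T : ℝ))) :=
    (hφL.indicator (measurableSet_Ioc (a := (0 : ℝ)) (b := (t : ℝ)))).toLp _
  -- the integrals over `(a m, t]`
  choose J hJ q hq hq1 hJq using fun m => hw.exists_mem_wienerGraph_leftSum (hat m) ht
    (hφ.mono hsub) (hφL.indicator (measurableSet_Ioc (a := (a m : ℝ)) (b := (t : ℝ)))).coeFn_toLp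
  have hpath : ∀ᵐ ω ∂P, ContinuousOn (fun s : ℝ => w s.toNNReal ω) (Icc 0 (T : ℝ)) := by
    filter_upwards [hw.continuous] with ω hω
    exact hω.comp continuous_real_toNNReal.continuousOn fun s hs =>
      ⟨zero_le, Real.toNNReal_le_iff_le_coe.2 hs.2⟩
  have hqY : ∀ m, (q m).2 =ᵐ[P] fun ω => φ t * w t ω - φ (a m) * w (a m) ω -
      ∫ s in Icc (a m : ℝ) t, w s.toNNReal ω * ψ s := by
    intro m
    refine ae_eq_of_tendsto_Lp_of_tendsto_ae (hJq m) ?_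
    filter_upwards [ae_all_iff.2 (hJ m), hpath] with ω h1 h2
    have h3 := tendsto_sum_mul_increment (hat m) (h2.mono hsub) (hφ.mono hsub)
      (fun s hs => hφψ s ⟨(a m).coe_nonneg.trans_lt hs.1, hs.2.trans_le ht⟩) (hψa m)
    simp only [Real.toNNReal_coe] at h3
    simpa only [h1] using h3
  obtain ⟨Q, hQ, hQ1, hqQ⟩ := hw.exists_mem_wienerGraph_of_tendsto hq
    (h := h) (by simpa only [hq1] using tendsto_toLp_indicator_Ioc hφL hat ha)
  have hQY : Q.2 =ᵐ[P] Y := by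
    refine ae_eq_of_tendsto_Lp_of_tendsto_ae hqQ ?_
    filter_upwards [ae_all_iff.2 hqY, hpath, hY, hint] with ω h1 h2 h3 h4
    simp only [h1, h3]
    have haw : Tendsto (fun m => (a m : ℝ)) atTop (𝓝[Icc 0 (t : ℝ)] 0) :=
      tendsto_nhdsWithin_iff.2 ⟨NNReal.tendsto_coe.2 ha,
        Eventually.of_forall fun m => ⟨(a m).coe_nonneg, hat m⟩⟩
    have h0 : (0 : ℝ) ∈ Icc 0 (t : ℝ) := ⟨le_rfl, t.coe_nonneg⟩
    have hsub0 : Icc 0 (t : ℝ) ⊆ Icc 0 (T : ℝ) := Icc_subset_Icc_right ht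
    have l1 : Tendsto (fun m => φ (a m)) atTop (𝓝 (φ 0)) :=
      ((hφ.mono hsub0) 0 h0).tendsto.comp haw
    have l2 : Tendsto (fun m => w (a m) ω) atTop (𝓝 (w 0 ω)) := by
      simpa [Function.comp_def] using ((h2.mono hsub0) 0 h0).tendsto.comp haw
    have l3 : Tendsto (fun m => ∫ s in Icc (a m : ℝ) t, w s.toNNReal ω * ψ s) atTop
        (𝓝 (∫ s in Icc 0 (t : ℝ), w s.toNNReal ω * ψ s)) := by
      have hc := intervalIntegral.continuousOn_primitive_interval_left (a := (0 : ℝ)) (b := t)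
        (f := fun s => w s.toNNReal ω * ψ s) (μ := volume)
        (by rw [uIcc_of_le t.coe_nonneg]; exact h4.mono_set hsub0)
      rw [uIcc_of_le t.coe_nonneg] at hc
      have hc' := (hc 0 h0).tendsto.comp haw
      simp only [integral_Icc_eq_integral_Ioc]
      rw [← intervalIntegral.integral_of_le t.coe_nonneg]
      refine hc'.congr fun m => ?_
      exact intervalIntegral.integral_of_le (NNReal.coe_le_coe.2 (hat m))
    exact (tendsto_const_nhds.sub (l1.mul l2)).sub l3
  -- the left-point sums over `[0, t]` converge to the same element of the graph
  have hφt : ContinuousOn φ (Icc ((0 : ℝ≥0) : ℝ) t) := hφ.mono hsub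
  obtain ⟨J₀, hJ₀, Q₀, hQ₀, hQ₀1, hJQ₀⟩ := hw.exists_mem_wienerGraph_leftSum zero_le ht hφt
    (h := h) (MemLp.coeFn_toLp _)
  have hQQ₀ : Q₀.2 = Q.2 := by
    have := hw.norm_fst_eq_norm_snd (Submodule.sub_mem _ hQ₀ hQ)
    rw [Prod.fst_sub, Prod.snd_sub, hQ₀1, hQ1, sub_self, norm_zero] at this
    exact sub_eq_zero.1 (norm_eq_zero.1 this.symm)
  rw [hQQ₀] at hJQ₀
  refine ⟨(memLp_congr_ae hQY).1 (Lp.memLp Q.2), leftPointProcess 𝓕 φ t,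
    tendsto_leftPointProcess_eval (by simpa using hφt), ?_⟩
  refine ((Lp.tendsto_Lp_iff_tendsto_eLpNorm' _ _).1 hJQ₀).congr fun n => eLpNorm_congr_ae ?_
  filter_upwards [hJ₀ n, hQY] with ω h1 h2
  rw [Pi.sub_apply, h1, h2, leftPointProcess_integral]

lemma itoIntegrable_deterministic {φ : ℝ → ℝ}
    (hφL : MemLp φ 2 (volume.restrict (Icc 0 (T : ℝ))))
    (hφ : ContinuousOn φ (Icc 0 (T : ℝ))) : ItoIntegrable 𝓕 P T (fun s _ => φ s) where
  progressive t ht := by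
    have hcont : Continuous fun s : Iic t => φ (s : ℝ≥0) :=
      hφ.comp_continuous (by fun_prop) fun s => ⟨s.1.coe_nonneg, s.2.trans ht⟩
    exact hcont.stronglyMeasurable.comp_measurable (@measurable_fst _ _ _ (𝓕 t))
  square_integrable := by
    have h1 : ∫⁻ s in Icc 0 (T : ℝ), ‖φ (s.toNNReal : ℝ)‖ₑ ^ 2 =
        ∫⁻ s in Icc 0 (T : ℝ), ‖φ s‖ₑ ^ 2 :=
      setLIntegral_congr_fun measurableSet_Icc fun s hs => by
        simp only [Real.coe_toNNReal s hs.1]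
    have h2 : ∫⁻ s in Icc 0 (T : ℝ), ‖φ s‖ₑ ^ 2 < ∞ := by
      have := lintegral_rpow_enorm_lt_top_of_eLpNorm_lt_top (p := 2) (by simp) (by simp) hφL.2
      simpa using this
    simp only [h1, lintegral_const]
    exact ENNReal.mul_lt_top h2 (measure_lt_top P _)

end Deterministic

/-! ### The stochastic Birkhoff integral -/

lemma measurable_indicator_Icc_derivWithin (φ : ℝ → ℝ) (a b : ℝ) :
    Measurable ((Icc a b).indicator (derivWithin φ (Icc a b))) := by
  -- the one-sided derivative differs from `deriv φ` only at the two endpoints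
  have h0 := (measurable_deriv φ).indicator (measurableSet_Ioo (a := a) (b := b))
  refine h0.measurable_of_countable_ne
    ((Set.toFinite {a, b}).countable.mono fun s hs => ?_)
  by_contra hab
  simp only [mem_insert_iff, mem_singleton_iff, not_or] at hab
  refine hs ?_
  by_cases h : s ∈ Icc a b
  · have h' : s ∈ Ioo a b := ⟨lt_of_le_of_ne h.1 (Ne.symm hab.1), lt_of_le_of_ne h.2 hab.2⟩
    rw [indicator_of_mem h, indicator_of_mem h', derivWithin_of_mem_nhds (Icc_mem_nhds h'.1 h'.2)]
  · rw [indicator_of_notMem h, indicator_of_notMem fun h' => h (Ioo_subset_Icc_self h')]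

end BirkhoffIto

theorem mainTheorem7 {Ω : Type*} {mΩ : MeasurableSpace Ω} (P : Measure Ω) [IsProbabilityMeasure P]
    (𝓕 : Filtration ℝ≥0 mΩ) (T : ℝ≥0) (hT : 0 < T)
    (w : ℝ≥0 → Ω → ℝ) (hw : BirkhoffIto.IsBrownianMotion 𝓕 P T w)
    {X : Type*} [NormedAddCommGroup X] [NormedSpace ℝ X] [CompleteSpace X]
    (Φ : ℝ → X) (hΦ : BirkhoffIto.StochasticBirkhoffIntegrable w T Φ)
    (hΦ' : BirkhoffIto.AdditionalHypothesis T Φ) (f : StrongDual ℝ X) :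
    BirkhoffIto.ItoIntegrable 𝓕 P T (fun s _ => f (Φ s)) ∧
      ∀ t ≤ T, BirkhoffIto.HasItoIntegral 𝓕 P w (fun s _ => f (Φ s)) t
        (fun ω => f (BirkhoffIto.stochasticBirkhoffIntegral w T Φ 0 t ω)) := by
  have hφ : ContinuousOn (fun s => f (Φ s)) (Icc 0 (T : ℝ)) := fun s hs =>
    (hΦ'.hasDeriv f s hs).continuousWithinAt
  refine ⟨BirkhoffIto.itoIntegrable_deterministic (hΦ'.memLp f) hφ, fun t ht => ?_⟩
  let ψ : ℝ → ℝ := (Icc 0 (T : ℝ)).indicator fun s => f (derivWithin Φ (Icc 0 (T : ℝ)) s)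
  have hψ : Measurable ψ := by
    have e : ψ = (Icc 0 (T : ℝ)).indicator
        (derivWithin (fun s => f (Φ s)) (Icc 0 (T : ℝ))) :=
      indicator_congr fun s hs => ((hΦ'.hasDeriv f s hs).derivWithin
        (uniqueDiffOn_Icc (NNReal.coe_pos.2 hT) s hs)).symm
    rw [e]
    exact BirkhoffIto.measurable_indicator_Icc_derivWithin _ _ _
  have hφψ : ∀ s ∈ Ioo 0 (T : ℝ), HasDerivAt (fun s => f (Φ s)) (ψ s) s := by
    intro s hs
    have hs' := Ioo_subset_Icc_self hs
    have := (hΦ'.hasDeriv f s hs').hasDerivAt (Icc_mem_nhds hs.1 hs.2)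
    simpa only [ψ, indicator_of_mem hs'] using this
  -- on almost every path the Birkhoff integrals become Lebesgue integrals
  have key : ∀ᵐ ω ∂P, ∀ u ≤ T,
      IntegrableOn (fun s => w s.toNNReal ω * ψ s) (Icc 0 (u : ℝ)) ∧
      f (BirkhoffIto.birkhoffIntegral
        (fun s : ℝ => w s.toNNReal ω • derivWithin Φ (Icc 0 (T : ℝ)) s) (Icc 0 (u : ℝ)) volume) =
        ∫ s in Icc 0 (u : ℝ), w s.toNNReal ω * ψ s := by
    filter_upwards [hw.continuous] with ω hω u hu
    have hcont : ContinuousOn (fun s : ℝ => w s.toNNReal ω) (Icc 0 (T : ℝ)) :=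
      hω.comp continuous_real_toNNReal.continuousOn fun s hs =>
        ⟨zero_le, Real.toNNReal_le_iff_le_coe.2 hs.2⟩
    have hsub : Icc 0 (u : ℝ) ⊆ Icc 0 (T : ℝ) := Icc_subset_Icc_right hu
    let W : ℝ → ℝ := IccExtend T.coe_nonneg ((Icc 0 (T : ℝ)).domRestrict fun s => w s.toNNReal ω)
    have hWm : Measurable W := hcont.domRestrict.Icc_extend'.measurable
    have hW : ∀ s ∈ Icc 0 (u : ℝ), W s = w s.toNNReal ω := fun s hs =>
      IccExtend_of_mem T.coe_nonneg _ (hsub hs)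
    have heq : EqOn (fun s => w s.toNNReal ω * ψ s) (fun s => W s * ψ s) (Icc 0 (u : ℝ)) :=
      fun s hs => by simp only [hW s hs]
    obtain ⟨h1, h2⟩ := (hΦ.integrable ω).integrableOn_and_apply_birkhoffIntegral
      measurableSet_Icc hsub (by simp) f (hWm.mul hψ) (fun s hs => by
        simp only [map_smul, smul_eq_mul, Pi.mul_apply, hW s hs, ψ, indicator_of_mem (hsub hs)])
    exact ⟨h1.congr_fun heq.symm measurableSet_Icc,
      h2.trans (setIntegral_congr_fun measurableSet_Icc heq.symm)⟩
  refine hw.hasItoIntegral_deterministic (hΦ'.memLp f) hφ hφψ hψ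
    (key.mono fun ω hω => (hω T le_rfl).1) ht ?_
  filter_upwards [key] with ω hω
  simp only [BirkhoffIto.stochasticBirkhoffIntegral, map_sub, map_smul, smul_eq_mul,
    NNReal.coe_zero, (hω t ht).2]
  ring
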